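/- Let $\langle\cdot,\cdot\rangle$ be an inner product on $\mathbb{R}^n$ with induced norm $\|\cdot\|$. Let $g:\mathbb{R}^n\to\mathbb{R}\cup\{\infty\}$ be proper, lower semi-continuous and convex, with $\mathrm{dom}\,g=\{x: g(x)<\infty\}$. Let $\mu,L>0$ and let $F:\mathbb{R}^n\to\mathbb{R}^n$ be $L$-Lipschitz on $\mathbb{R}^n$ and strongly monotone with modulus $\mu$ on $\mathrm{dom}\,g$, i.e. $\langle F(x)-F(y),x-y\rangle\ge\mu\|x-y\|^2$ for all $x,y\in\mathrm{dom}\,g$. A solution of the mixed variational inequality problem $\mathrm{MVI}(F,g)$ is a point $x\in\mathrm{dom}\,g$ with $\langle F(x),z-x\rangle+g(z)-g(x)\ge 0$ for all $z\in\mathbb{R}^n$. For $\lambda>0$ put $$y(x)=\mathrm{prox}_{\lambda g}(x-\lambda F(x)),\qquad \mathrm{prox}_{w}(x)=\operatorname*{arg\,min}_{z\in\mathbb{R}^n}\Big(w(z)+\tfrac12\|x-z\|^2\Big),$$ and for $\kappa_1,\kappa_2>0$, $\alpha_1\in(0,1)$, $\alpha_2>1$ consider the modified proximal dynamical system $$\dot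 x=-\rho(x)\,(x-y(x)),\qquad \rho(x)=\begin{cases}0,& y(x)=x,\\ \dfrac{\kappa_1}{\|x-y(x)\|^{1-\alpha_1}}+\dfrac{\kappa_2}{\|x-y(x)\|^{1-\alpha_2}},&\text{otherwise.}\end{cases}\tag{$*$}$$ Theorem 2. The problem $\mathrm{MVI}(F,g)$ has exactly one solution $x^*$. For every $\lambda\in(0,2\mu/L^2)$ there is $\varepsilon>0$ such that for all $\kappa_1,\kappa_2>0$, all $\alpha_1\in(1-\varepsilon,1)\cap(0,1)$ and all $\alpha_2>1$ the following hold. 1. The right-hand side of $(*)$ is continuous, and from every $x(0)\in\mathbb{R}^n$ the system $(*)$ has a solution defined for all $t\ge 0$; every solution of $(*)$ on an interval $[0,\tau)$, $\tau>0$, with the same initial condition coincides with it on $[0,\tau)$. 2. The point $x^*$ is a fixed-time stable equilibrium point of $(*)$: the right-hand side vanishes at $x^*$; $x^*$ is stable in the sense of Lyapunov; and there is a settling-time function $T:\mathbb{R}^n\setminus\{x^*\}\to(0,\infty)$ such that for every $x(0)\ne x^*$ the solution satisfies $x(t)\ne x^*$ for $t\in[0,T(x(0)))$ and $\lim_{t\to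 T(x(0))}x(t)=x^*$, with $T$ bounded uniformly over all initial conditions: $\sup_{x(0)\neq x^*}T(x(0))<\infty$. -/

import Mathlib

open Set Filter Topology

noncomputable section

namespace MVIP

variable {E : Type*} [NormedAddCommGroup E] [InnerProductSpace ℝ E]

/-! ### Extended-valued convex functions and operators -/

/-- The effective domain of an extended real valued function. -/
def dom (g : E → EReal) : Set E := {x | g x < ⊤}

/-- A proper, lower semi-continuous, convex function with values in `ℝ ∪ {∞}`. -/
structure IsProperLscConvex (g : E → EReal) : Prop where
  ne_bot : ∀ x, g x ≠ ⊥
  dom_nonempty : (dom g).Nonempty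
  lsc : LowerSemicontinuous g
  convex : ∀ (x y : E) (a b : ℝ), 0 < a → 0 < b → a + b = 1 →
    g (a • x + b • y) ≤ (a : EReal) * g x + (b : EReal) * g y

/-- `F` is strongly monotone with modulus `μ` on the set `S`. -/
def StronglyMonotoneOn (μ : ℝ) (F : E → E) (S : Set E) : Prop :=
  ∀ x ∈ S, ∀ y ∈ S, μ * ‖x - y‖ ^ 2 ≤ inner ℝ (F x - F y) (x - y)

/-- `F` is Lipschitz continuous with constant `L` on the whole space. -/
def IsLipschitz (L : ℝ) (F : E → E) : Prop :=
  ∀ x y : E, ‖F x - F y‖ ≤ L * ‖x - y‖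

/-- `x` solves the mixed variational inequality problem `MVI(F, g)`: the point `x` lies in the
domain of `g` and `⟨F x, z - x⟩ + g z - g x ≥ 0` for all `z`. -/
def IsSolution (F : E → E) (g : E → EReal) (x : E) : Prop :=
  x ∈ dom g ∧ ∀ z : E, 0 ≤ ((inner ℝ (F x) (z - x) : ℝ) : EReal) + g z - g x

/-! ### The proximal operator and the modified proximal vector field -/

/-- The objective `z ↦ w z + ‖x - z‖² / 2` minimized by the proximal operator at `x`. -/
def proxObjective (w : E → EReal) (x z : E) : EReal :=
  w z + ((1 / 2 * ‖x - z‖ ^ 2 : ℝ) : EReal)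

/-- The proximal operator: a (for proper lower semi-continuous convex `w`: the) global minimizer
of `proxObjective w x`. -/
def prox (w : E → EReal) (x : E) : E :=
  Classical.epsilon fun y => ∀ z : E, proxObjective w x y ≤ proxObjective w x z

/-- The map `y(x) = prox_{lam g} (x - lam F x)`. -/
def proxStep (F : E → E) (g : E → EReal) (lam : ℝ) (x : E) : E :=
  prox (fun z => (lam : EReal) * g z) (x - lam • F x)

open Classical in
/-- The scaling factor `ρ` of the modified proximal dynamical system. -/
def rho (F : E → E) (g : E → EReal) (lam κ₁ κ₂ α₁ α₂ : ℝ) (x : E) : ℝ :=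
  if proxStep F g lam x = x then 0
  else κ₁ * (1 / ‖x - proxStep F g lam x‖ ^ (1 - α₁))
    + κ₂ * (1 / ‖x - proxStep F g lam x‖ ^ (1 - α₂))

/-- The right-hand side `-ρ(x) (x - y(x))` of the modified proximal dynamical system. -/
def modifiedField (F : E → E) (g : E → EReal) (lam κ₁ κ₂ α₁ α₂ : ℝ) (x : E) : E :=
  -(rho F g lam κ₁ κ₂ α₁ α₂ x • (x - proxStep F g lam x))

/-! ### Autonomous differential equations and fixed-time stability -/

/-- `φ` is a (classical) solution of `ẋ = X(x)`, `x(0) = x₀` on the time interval `I`;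
derivatives at an endpoint of `I` are one-sided. -/
def IsTrajectoryOn (X : E → E) (x₀ : E) (I : Set ℝ) (φ : ℝ → E) : Prop :=
  φ 0 = x₀ ∧ ∀ t ∈ I, HasDerivWithinAt φ (X (φ t)) I t

/-- From every initial condition there is a solution for all `t ≥ 0`, and every solution on an
interval `[0, τ)` with the same initial condition agrees with it there. -/
def ForwardWellPosed (X : E → E) : Prop :=
  ∀ x₀ : E, ∃ φ : ℝ → E, IsTrajectoryOn X x₀ (Ici 0) φ ∧
    ∀ (τ : ℝ) (ψ : ℝ → E), 0 < τ → IsTrajectoryOn X x₀ (Ico 0 τ) ψ → EqOn ψ φ (Ico 0 τ)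

/-- Stability of the point `p` in the sense of Lyapunov. -/
def LyapunovStable (X : E → E) (p : E) : Prop :=
  ∀ ε > 0, ∃ δ > 0, ∀ (x₀ : E) (φ : ℝ → E), ‖x₀ - p‖ < δ → IsTrajectoryOn X x₀ (Ici 0) φ →
    ∀ t, 0 ≤ t → ‖φ t - p‖ < ε

/-- `T` is a settling-time function for `p` on `N`; only its values on `N \ {p}` matter. -/
def IsSettlingTime (X : E → E) (p : E) (N : Set E) (T : E → ℝ) : Prop :=
  ∀ x₀ ∈ N \ {p}, 0 < T x₀ ∧ ∀ φ : ℝ → E, IsTrajectoryOn X x₀ (Ici 0) φ →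
    (∀ t ∈ Ico 0 (T x₀), φ t ∈ N \ {p}) ∧ Tendsto φ (𝓝 (T x₀)) (𝓝 p)

/-- `p` is a fixed-time stable equilibrium point of `ẋ = X(x)`: it is an equilibrium, it is
stable in the sense of Lyapunov, and there is a settling-time function on the whole space that is
bounded uniformly over all initial conditions. -/
def FixedTimeStable (X : E → E) (p : E) : Prop :=
  X p = 0 ∧ LyapunovStable X p ∧
    ∃ T : E → ℝ, IsSettlingTime X p univ T ∧ BddAbove (T '' {p}ᶜ)

end MVIP

end

/-! Write y for `proxStep F g lam` and C for the closure of `dom g`. Solutions of the MVI are the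
fixed points of y. The map y takes values in `dom g`, contracts C with a factor c < 1, and is
Lipschitz everywhere; so Banach's theorem on C gives the unique solution p.

Off C nothing forces y to bring points closer to p, so ‖x - p‖ alone need not be a Lyapunov
function. The remedy is W(x) = ‖x - p‖ + K dist(x, C) with K large: y x lies in C, the penalty
disappears after one step, and W(y x) ≤ θ W(x) with θ < 1 (`exists_isConvexLyapunov`). As W is
convex and the field points from x towards y x, the Dini derivative of W along the flow is at most
-ρ (1 - θ) W (`slope_lt`). The residual ‖x - y x‖ is comparable to W, so W' ≤ -(A W^α₁ + B W^α₂),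
which forces W = 0 after a time independent of the start (`eq_zero_of_frequently_slope_lt`).

The field is locally Lipschitz except at p. Cutting off the gain at small residuals gives Lipschitz
fields; since W decreases, their solutions agree until all are near p, hence converge uniformly to a
solution (`exists_solution_Icc`). Uniqueness holds away from p, and p is never left once reached
(`forward_unique`). -/

namespace MVIP

/-! ### Existence and variational characterization of proximal points. -/

section Prox

variable {E : Type*} [NormedAddCommGroup E] [InnerProductSpace ℝ E]
  {F : E → E} {g : E → EReal} {lam : ℝ}

/-- The variational characterization of the proximal point `p` of `lam • g` at `u`. -/
def IsProxPoint (g : E → EReal) (lam : ℝ) (u p : E) : Prop :=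
  p ∈ dom g ∧ ∀ z ∈ dom g, inner ℝ (u - p) (z - p) ≤ lam * ((g z).toReal - (g p).toReal)

namespace IsProperLscConvex

theorem coe_toReal (hg : IsProperLscConvex g) {x : E} (hx : x ∈ dom g) :
    ((g x).toReal : EReal) = g x :=
  EReal.coe_toReal (ne_of_lt hx) (hg.ne_bot x)

theorem combo_mem (hg : IsProperLscConvex g) {x y : E} (hx : x ∈ dom g) (hy : y ∈ dom g)
    {a b : ℝ} (ha : 0 < a) (hb : 0 < b) (hab : a + b = 1) :
    a • x + b • y ∈ dom g ∧
      (g (a • x + b • y)).toReal ≤ a * (g x).toReal + b * (g y).toReal := by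
  have h := hg.convex x y a b ha hb hab
  rw [← hg.coe_toReal hx, ← hg.coe_toReal hy] at h
  have h' : g (a • x + b • y) ≤ ((a * (g x).toReal + b * (g y).toReal : ℝ) : EReal) := by
    exact_mod_cast h
  have hm : a • x + b • y ∈ dom g := lt_of_le_of_lt h' (EReal.coe_lt_top _)
  refine ⟨hm, ?_⟩
  rw [← hg.coe_toReal hm] at h'
  exact_mod_cast h'

theorem convex_dom (hg : IsProperLscConvex g) : Convex ℝ (dom g) :=
  convex_iff_forall_pos.2 fun _ hx _ hy _ _ ha hb hab => (hg.combo_mem hx hy ha hb hab).1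

theorem proxObjective_of_mem (hg : IsProperLscConvex g) (x : E) {z : E} (hz : z ∈ dom g) :
    proxObjective (fun z => (lam : EReal) * g z) x z
      = ((lam * (g z).toReal + 1 / 2 * ‖x - z‖ ^ 2 : ℝ) : EReal) := by
  unfold proxObjective
  beta_reduce
  rw [← hg.coe_toReal hz, EReal.toReal_coe, ← EReal.coe_mul, ← EReal.coe_add]

theorem proxObjective_of_notMem {E : Type*} [NormedAddCommGroup E] {g : E → EReal}
    (hlam : 0 < lam) (x : E) {z : E} (hz : z ∉ dom g) :
    proxObjective (fun z => (lam : EReal) * g z) x z = ⊤ := by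
  have : g z = ⊤ := by simpa [dom] using hz
  simp only [proxObjective, this, EReal.coe_mul_top_of_pos hlam, EReal.top_add_coe]

/-- Along rays from a point of the domain, a convex function decreases at most linearly. -/
theorem exists_linear_lower_bound [FiniteDimensional ℝ E] (hg : IsProperLscConvex g) {x₀ : E}
    (hx₀ : x₀ ∈ dom g) :
    ∃ m : ℝ, 0 ≤ m ∧ ∀ z ∈ dom g, (g x₀).toReal - m * (1 + ‖z - x₀‖) ≤ (g z).toReal := by
  obtain ⟨u, hu, hmin⟩ := LowerSemicontinuousOn.exists_isMinOn
    (Metric.nonempty_closedBall.2 zero_le_one) (isCompact_closedBall x₀ (1 : ℝ))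
    (hg.lsc.lowerSemicontinuousOn _)
  have hle : ∀ z ∈ Metric.closedBall x₀ (1 : ℝ), g u ≤ g z := fun z hz => hmin hz
  have hux₀ := hle x₀ (Metric.mem_closedBall_self zero_le_one)
  have hud : u ∈ dom g := lt_of_le_of_lt hux₀ hx₀
  have hle' : ∀ z ∈ dom g, ‖z - x₀‖ ≤ 1 → (g u).toReal ≤ (g z).toReal := fun z hz hz1 =>
    EReal.toReal_le_toReal (hle z (by rwa [mem_closedBall_iff_norm])) (hg.ne_bot u) (ne_of_lt hz)
  have h0 := hle' x₀ hx₀ (by simp)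
  -- `m` is the drop of `g` from `x₀` to its minimum on the unit ball. A point at distance s > 1 is
  -- pulled back to the unit sphere by the factor s⁻¹, and convexity multiplies the drop by at most
  -- s.
  refine ⟨(g x₀).toReal - (g u).toReal, by linarith, fun z hz => ?_⟩
  rcases le_or_gt ‖z - x₀‖ 1 with h1 | h1
  · have := hle' z hz h1
    nlinarith [norm_nonneg (z - x₀)]
  · set s := ‖z - x₀‖
    have hs : 0 < s := by linarith
    have hs1 : s⁻¹ < 1 := inv_lt_one_of_one_lt₀ h1
    obtain ⟨hm, hc⟩ := hg.combo_mem hx₀ hz (a := 1 - s⁻¹) (b := s⁻¹) (by linarith)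
      (inv_pos.2 hs) (by ring)
    have heq : (1 - s⁻¹) • x₀ + s⁻¹ • z - x₀ = s⁻¹ • (z - x₀) := by module
    have := hle' _ hm (by
      rw [heq, norm_smul, norm_inv, Real.norm_of_nonneg hs.le, inv_mul_cancel₀ hs.ne'])
    have h2 : (g u).toReal ≤ (1 - s⁻¹) * (g x₀).toReal + s⁻¹ * (g z).toReal := this.trans hc
    have h3 := mul_le_mul_of_nonneg_left h2 hs.le
    have h4 : s * ((1 - s⁻¹) * (g x₀).toReal + s⁻¹ * (g z).toReal)
        = (s - 1) * (g x₀).toReal + (g z).toReal := by field_simp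
    rw [h4] at h3
    nlinarith

/-- The quadratic term beats the linear lower bound on `g`, so the search reduces to a compact ball.
-/
theorem exists_prox_minimizer [FiniteDimensional ℝ E] (hg : IsProperLscConvex g) (hlam : 0 < lam)
    (x : E) : ∃ p : E, ∀ z : E, proxObjective (fun z => (lam : EReal) * g z) x p
      ≤ proxObjective (fun z => (lam : EReal) * g z) x z := by
  obtain ⟨x₀, hx₀⟩ := hg.dom_nonempty
  obtain ⟨m, hm0, hm⟩ := hg.exists_linear_lower_bound hx₀
  have hlsc : LowerSemicontinuous (proxObjective (fun z => (lam : EReal) * g z) x) := by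
    refine LowerSemicontinuous.add' ?_ ?_ fun z =>
      EReal.continuousAt_add (.inr (EReal.coe_ne_bot _)) (.inr (EReal.coe_ne_top _))
    · refine Continuous.comp_lowerSemicontinuous (g := fun t : EReal => (lam : EReal) * t) ?_
        hg.lsc fun a b hab => mul_le_mul_of_nonneg_left hab (by exact_mod_cast hlam.le)
      refine continuous_iff_continuousAt.2 fun t => ?_
      exact (EReal.continuousAt_mul (p := ((lam : EReal), t)) (by simp [hlam.ne'])
        (by simp [hlam.ne']) (by simp) (by simp)).comp (f := fun t : EReal => ((lam : EReal), t))
        (by fun_prop)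
    · exact (continuous_coe_real_ereal.comp (by fun_prop)).lowerSemicontinuous
  set R : ℝ := ‖x - x₀‖
  -- For d = ‖z - x₀‖ > r one has d (d - 2R - 2 lam m) ≥ 2 lam m, which says that the lower bound
  -- for the objective at z exceeds its value at `x₀`.
  set r : ℝ := 2 * R + 2 * lam * m + 1
  have hR : 0 ≤ R := norm_nonneg _
  have hlm : 0 ≤ lam * m := by positivity
  have hr : 0 ≤ r := by simp only [r]; linarith
  obtain ⟨p, hp, hmin⟩ := LowerSemicontinuousOn.exists_isMinOn
    (Metric.nonempty_closedBall.2 hr) (isCompact_closedBall x₀ r)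
    (hlsc.lowerSemicontinuousOn _)
  refine ⟨p, fun z => ?_⟩
  by_cases hz : z ∈ Metric.closedBall x₀ r
  · exact hmin hz
  refine (hmin (Metric.mem_closedBall_self hr)).trans ?_
  by_cases hzd : z ∈ dom g
  · rw [hg.proxObjective_of_mem x hx₀, hg.proxObjective_of_mem x hzd, EReal.coe_le_coe_iff]
    have h1 := mul_le_mul_of_nonneg_left (hm z hzd) hlam.le
    have h2 : r < ‖z - x₀‖ := by rwa [mem_closedBall_iff_norm, not_le] at hz
    have h3 : ‖z - x₀‖ ≤ ‖x - z‖ + R := by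
      have := norm_sub_le (x - x₀) (x - z)
      rw [show x - x₀ - (x - z) = z - x₀ by abel] at this
      linarith
    have h5 : (‖z - x₀‖ - R) ^ 2 ≤ ‖x - z‖ ^ 2 := by
      apply pow_le_pow_left₀ <;> simp only [r] at h2 <;> linarith
    simp only [r] at h2
    change lam * (g x₀).toReal + 1 / 2 * R ^ 2 ≤ _
    nlinarith
  · rw [proxObjective_of_notMem hlam x hzd]
    exact le_top

/-- First-order condition: compare p with (1 - t) p + t z, divide by t and let t → 0. -/
theorem isProxPoint_of_minimizer (hg : IsProperLscConvex g) (hlam : 0 < lam) {x p : E}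
    (hp : ∀ z : E, proxObjective (fun z => (lam : EReal) * g z) x p
      ≤ proxObjective (fun z => (lam : EReal) * g z) x z) : IsProxPoint g lam x p := by
  have hpd : p ∈ dom g := by
    by_contra hpd
    obtain ⟨x₀, hx₀⟩ := hg.dom_nonempty
    have := hp x₀
    rw [proxObjective_of_notMem hlam x hpd, hg.proxObjective_of_mem x hx₀] at this
    exact absurd this (not_le.2 (EReal.coe_lt_top _))
  refine ⟨hpd, fun z hz => ?_⟩
  have key : ∀ t ∈ Ioo (0 : ℝ) 1,
      inner ℝ (x - p) (z - p) - lam * ((g z).toReal - (g p).toReal) ≤ t * (‖z - p‖ ^ 2 / 2) := by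
    rintro t ⟨ht0, ht1⟩
    obtain ⟨hm, hc⟩ := hg.combo_mem hpd hz (a := 1 - t) (b := t) (by linarith) ht0 (by ring)
    have h := hp ((1 - t) • p + t • z)
    rw [hg.proxObjective_of_mem x hpd, hg.proxObjective_of_mem x hm, EReal.coe_le_coe_iff,
      show x - ((1 - t) • p + t • z) = (x - p) - t • (z - p) by module,
      norm_sub_sq_real (x - p), norm_smul, inner_smul_right, Real.norm_of_nonneg ht0.le] at h
    have h1 := mul_le_mul_of_nonneg_left hc hlam.le
    have h2 : t * (inner ℝ (x - p) (z - p) - lam * ((g z).toReal - (g p).toReal))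
        ≤ t * (t * (‖z - p‖ ^ 2 / 2)) := by nlinarith
    exact le_of_mul_le_mul_left h2 ht0
  have hlim : Tendsto (fun t : ℝ => t * (‖z - p‖ ^ 2 / 2)) (𝓝[>] 0) (𝓝 0) := by
    have : Tendsto (fun t : ℝ => t * (‖z - p‖ ^ 2 / 2)) (𝓝 0) (𝓝 (0 * (‖z - p‖ ^ 2 / 2))) :=
      tendsto_id.mul_const _
    rw [zero_mul] at this
    exact this.mono_left nhdsWithin_le_nhds
  have := ge_of_tendsto hlim (by
    filter_upwards [Ioo_mem_nhdsGT (zero_lt_one (α := ℝ))] with t ht using key t ht)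
  linarith

theorem isProxPoint_prox [FiniteDimensional ℝ E] (hg : IsProperLscConvex g) (hlam : 0 < lam)
    (x : E) : IsProxPoint g lam x (prox (fun z => (lam : EReal) * g z) x) :=
  hg.isProxPoint_of_minimizer hlam (Classical.epsilon_spec (hg.exists_prox_minimizer hlam x))

end IsProperLscConvex

/-- Firm nonexpansiveness: test each variational inequality at the other point and add; the values
of `g` cancel. -/
theorem IsProxPoint.sq_norm_sub_le {u v p q : E} (hp : IsProxPoint g lam u p)
    (hq : IsProxPoint g lam v q) : ‖p - q‖ ^ 2 ≤ inner ℝ (u - v) (p - q) := by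
  have h1 := hp.2 q hq.1
  have h2 := hq.2 p hp.1
  have e : inner ℝ (u - p) (q - p) + inner ℝ (v - q) (p - q)
      = ‖p - q‖ ^ 2 - inner ℝ (u - v) (p - q) := by
    rw [← real_inner_self_eq_norm_sq, ← inner_sub_left, ← neg_sub p q, inner_neg_right,
      ← inner_neg_left, ← inner_add_left]
    congr 1
    abel
  linarith

theorem IsProxPoint.norm_sub_le {u v p q : E} (hp : IsProxPoint g lam u p)
    (hq : IsProxPoint g lam v q) : ‖p - q‖ ≤ ‖u - v‖ := by
  have h := (hp.sq_norm_sub_le hq).trans (real_inner_le_norm _ _)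
  rcases (norm_nonneg (p - q)).eq_or_lt with h0 | h0
  · rw [← h0]; exact norm_nonneg _
  · rw [sq] at h
    exact le_of_mul_le_mul_right h h0

theorem IsProxPoint.eq {u p q : E} (hp : IsProxPoint g lam u p) (hq : IsProxPoint g lam u q) :
    p = q := by
  have h := hp.norm_sub_le hq
  rw [sub_self, norm_zero] at h
  exact sub_eq_zero.1 (norm_le_zero_iff.1 h)

theorem isSolution_iff_isProxPoint (hg : IsProperLscConvex g) (hlam : 0 < lam) {x : E} :
    IsSolution F g x ↔ IsProxPoint g lam (x - lam • F x) x := by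
  refine and_congr_right fun hx => ?_
  have hin : ∀ z, inner ℝ (x - lam • F x - x) (z - x) = -(lam * inner ℝ (F x) (z - x)) := by
    intro z
    rw [show x - lam • F x - x = -(lam • F x) by abel, inner_neg_left, real_inner_smul_left]
  have hiff : ∀ z ∈ dom g, (0 ≤ ((inner ℝ (F x) (z - x) : ℝ) : EReal) + g z - g x ↔
      0 ≤ inner ℝ (F x) (z - x) + (g z).toReal - (g x).toReal) := by
    intro z hz
    rw [← hg.coe_toReal hz, ← hg.coe_toReal hx, EReal.toReal_coe, EReal.toReal_coe]
    norm_cast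
  constructor
  · intro h z hz
    have := mul_nonneg hlam.le ((hiff z hz).1 (h z))
    rw [hin]
    linarith
  · intro h z
    by_cases hz : z ∈ dom g
    · rw [hiff z hz]
      have h1 := h z hz
      rw [hin] at h1
      refine nonneg_of_mul_nonneg_right (a := lam) ?_ hlam
      linarith
    · have : g z = ⊤ := by simpa [dom] using hz
      rw [this, EReal.coe_add_top, ← hg.coe_toReal hx, EReal.top_sub_coe]
      exact le_top

end Prox

/-! ### Forward-backward step, its contraction on the closed domain, and unique solvability. -/

section Contraction

variable {E : Type*} [NormedAddCommGroup E] [InnerProductSpace ℝ E]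
  {F : E → E} {g : E → EReal} {lam μ L : ℝ}

theorem IsLipschitz.continuous {E : Type*} [NormedAddCommGroup E] {F : E → E}
    (hF : IsLipschitz L F) : Continuous F :=
  (LipschitzWith.of_dist_le' (K := L) fun x y => by
    rw [dist_eq_norm, dist_eq_norm]; exact hF x y).continuous

/-- `dom g` need not be closed, while Banach's theorem and nearest points require a closed set. -/
theorem StronglyMonotoneOn.on_closure {S : Set E} (hF : Continuous F)
    (h : StronglyMonotoneOn μ F S) : StronglyMonotoneOn μ F (closure S) := by
  have hcl : IsClosed {q : E × E |
      μ * ‖q.1 - q.2‖ ^ 2 ≤ inner ℝ (F q.1 - F q.2) (q.1 - q.2)} :=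
    isClosed_le (by fun_prop) (by fun_prop)
  intro x hx y hy
  have hmem : (x, y) ∈ closure (S ×ˢ S) := by
    rw [closure_prod_eq]
    exact ⟨hx, hy⟩
  exact closure_minimal (fun q hq => h q.1 hq.1 q.2 hq.2) hcl hmem

/-- The contraction factor of the forward step `x ↦ x - lam • F x`. -/
noncomputable def contractionFactor (μ L lam : ℝ) : ℝ := √(1 - 2 * lam * μ + lam ^ 2 * L ^ 2)

theorem contractionFactor_nonneg : 0 ≤ contractionFactor μ L lam := Real.sqrt_nonneg _

theorem contractionFactor_lt_one (hL : 0 < L) (hlam : lam ∈ Ioo (0 : ℝ) (2 * μ / L ^ 2)) :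
    contractionFactor μ L lam < 1 := by
  rw [contractionFactor, Real.sqrt_lt' one_pos]
  have h := (lt_div_iff₀ (by positivity : 0 < L ^ 2)).1 hlam.2
  nlinarith [mul_lt_mul_of_pos_left h hlam.1]

theorem norm_forward_sub_le {S : Set E} (hLip : IsLipschitz L F)
    (hmono : StronglyMonotoneOn μ F S) (hlam : 0 < lam) {x y : E} (hx : x ∈ S) (hy : y ∈ S) :
    ‖(x - lam • F x) - (y - lam • F y)‖ ≤ contractionFactor μ L lam * ‖x - y‖ := by
  have hsq : ‖(x - lam • F x) - (y - lam • F y)‖ ^ 2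
      ≤ (1 - 2 * lam * μ + lam ^ 2 * L ^ 2) * ‖x - y‖ ^ 2 := by
    rw [show (x - lam • F x) - (y - lam • F y) = (x - y) - lam • (F x - F y) by module,
      norm_sub_sq_real, norm_smul, real_inner_smul_right, Real.norm_of_nonneg hlam.le,
      real_inner_comm, mul_pow]
    have h1 := mul_le_mul_of_nonneg_left (hmono x hx y hy) hlam.le
    have h2 : ‖F x - F y‖ ^ 2 ≤ (L * ‖x - y‖) ^ 2 :=
      pow_le_pow_left₀ (norm_nonneg _) (hLip x y) 2
    have h3 := mul_le_mul_of_nonneg_left h2 (sq_nonneg lam)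
    nlinarith
  calc ‖(x - lam • F x) - (y - lam • F y)‖ = √(‖(x - lam • F x) - (y - lam • F y)‖ ^ 2) :=
        (Real.sqrt_sq (norm_nonneg _)).symm
    _ ≤ √((1 - 2 * lam * μ + lam ^ 2 * L ^ 2) * ‖x - y‖ ^ 2) := Real.sqrt_le_sqrt hsq
    _ = contractionFactor μ L lam * ‖x - y‖ := by
        rw [Real.sqrt_mul' _ (sq_nonneg _), Real.sqrt_sq (norm_nonneg _), contractionFactor]

/-- A bound valid off the domain, where monotonicity is not available. -/
theorem norm_forward_sub_le' (hLip : IsLipschitz L F) (hlam : 0 < lam) (x y : E) :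
    ‖(x - lam • F x) - (y - lam • F y)‖ ≤ (1 + lam * L) * ‖x - y‖ := by
  rw [show (x - lam • F x) - (y - lam • F y) = (x - y) - lam • (F x - F y) by module]
  refine (norm_sub_le _ _).trans ?_
  rw [norm_smul, Real.norm_of_nonneg hlam.le]
  have := mul_le_mul_of_nonneg_left (hLip x y) hlam.le
  linarith

variable [FiniteDimensional ℝ E]

theorem isProxPoint_proxStep (hg : IsProperLscConvex g) (hlam : 0 < lam) (x : E) :
    IsProxPoint g lam (x - lam • F x) (proxStep F g lam x) :=
  hg.isProxPoint_prox hlam _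

theorem norm_proxStep_sub_le (hg : IsProperLscConvex g) (hlam : 0 < lam) (x y : E) :
    ‖proxStep F g lam x - proxStep F g lam y‖ ≤ ‖(x - lam • F x) - (y - lam • F y)‖ :=
  (isProxPoint_proxStep hg hlam x).norm_sub_le (isProxPoint_proxStep hg hlam y)

theorem isSolution_iff_proxStep_eq (hg : IsProperLscConvex g) (hlam : 0 < lam) {x : E} :
    IsSolution F g x ↔ proxStep F g lam x = x := by
  rw [isSolution_iff_isProxPoint hg hlam]
  refine ⟨fun h => (isProxPoint_proxStep hg hlam x).eq h, fun h => ?_⟩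
  have := isProxPoint_proxStep (F := F) hg hlam x
  rwa [h] at this

theorem existsUnique_isSolution (hμ : 0 < μ) (hL : 0 < L) (hg : IsProperLscConvex g)
    (hmono : StronglyMonotoneOn μ F (dom g)) (hLip : IsLipschitz L F) :
    ∃! x : E, IsSolution F g x := by
  -- Any admissible step size would do, since solutions do not depend on it; this is the midpoint.
  have hlam : μ / L ^ 2 ∈ Ioo (0 : ℝ) (2 * μ / L ^ 2) := by
    refine ⟨by positivity, ?_⟩
    gcongr
    linarith
  set lam := μ / L ^ 2
  have hlt := contractionFactor_lt_one hL hlam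
  have hcl := hmono.on_closure hLip.continuous
  have hcontr : ∀ x ∈ closure (dom g), ∀ y ∈ closure (dom g),
      ‖proxStep F g lam x - proxStep F g lam y‖ ≤ contractionFactor μ L lam * ‖x - y‖ :=
    fun x hx y hy => (norm_proxStep_sub_le hg hlam.1 x y).trans
      (norm_forward_sub_le hLip hcl hlam.1 hx hy)
  have hmaps : MapsTo (proxStep F g lam) (closure (dom g)) (closure (dom g)) :=
    fun x _ => subset_closure (isProxPoint_proxStep hg hlam.1 x).1
  have hCW : ContractingWith ⟨contractionFactor μ L lam, contractionFactor_nonneg⟩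
      (hmaps.restrict (proxStep F g lam) _ _) := by
    refine ⟨by exact_mod_cast hlt, LipschitzWith.of_dist_le_mul fun x y => ?_⟩
    rw [Subtype.dist_eq, Subtype.dist_eq, dist_eq_norm, dist_eq_norm]
    exact hcontr x x.2 y y.2
  obtain ⟨x₀, hx₀⟩ := hg.dom_nonempty
  obtain ⟨x, _, hfix, -⟩ := ContractingWith.exists_fixedPoint' isClosed_closure.isComplete hmaps
    hCW (subset_closure hx₀) (edist_ne_top _ _)
  refine ⟨x, (isSolution_iff_proxStep_eq hg hlam.1).2 hfix, fun y hy => ?_⟩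
  have hx := (isSolution_iff_proxStep_eq hg hlam.1).2 hfix
  have h := hcontr y (subset_closure hy.1) x (subset_closure hx.1)
  rw [(isSolution_iff_proxStep_eq hg hlam.1).1 hy, hfix] at h
  have h0 : ‖y - x‖ ≤ 0 := by nlinarith [norm_nonneg (y - x)]
  exact sub_eq_zero.1 (norm_le_zero_iff.1 h0)

end Contraction

/-! ### Convex Lyapunov functions for averaging maps -/

/-- `W` is a convex Lyapunov function at the fixed point `p` of the Lipschitz map `y`: it
dominates the distance to `p` and is contracted by `y` with the factor `θ`. -/
structure IsConvexLyapunov {E : Type*} [NormedAddCommGroup E] [NormedSpace ℝ E]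
    (y : E → E) (p : E) (W : E → ℝ) (ℓ M θ : ℝ) : Prop where
  ℓ_nonneg : 0 ≤ ℓ
  M_pos : 0 < M
  θ_lt_one : θ < 1
  lipschitz_map : ∀ a b, ‖y a - y b‖ ≤ ℓ * ‖a - b‖
  map_fixed : y p = p
  norm_le : ∀ x, ‖x - p‖ ≤ W x
  fixed : W p = 0
  lipschitz : ∀ a b, |W a - W b| ≤ M * ‖a - b‖
  convexOn : ConvexOn ℝ univ W
  contracts : ∀ x, W (y x) ≤ θ * W x

theorem convexOn_infDist {E : Type*} [NormedAddCommGroup E] [NormedSpace ℝ E] {C : Set E}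
    (hC : Convex ℝ C) (hne : C.Nonempty) : ConvexOn ℝ univ fun x => Metric.infDist x C := by
  refine ⟨convex_univ, fun x _ y _ a b ha hb hab => le_of_forall_pos_le_add fun ε hε => ?_⟩
  obtain ⟨u, hu, hxu⟩ := (Metric.infDist_lt_iff hne).1 (lt_add_of_pos_right (Metric.infDist x C) hε)
  obtain ⟨v, hv, hyv⟩ := (Metric.infDist_lt_iff hne).1 (lt_add_of_pos_right (Metric.infDist y C) hε)
  refine (Metric.infDist_le_dist_of_mem (hC hu hv ha hb hab)).trans ?_
  rw [dist_eq_norm] at hxu hyv ⊢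
  rw [show a • x + b • y - (a • u + b • v) = a • (x - u) + b • (y - v) by module]
  refine (norm_add_le _ _).trans ?_
  rw [norm_smul, norm_smul, Real.norm_of_nonneg ha, Real.norm_of_nonneg hb, smul_eq_mul,
    smul_eq_mul]
  nlinarith [mul_le_mul_of_nonneg_left hxu.le ha, mul_le_mul_of_nonneg_left hyv.le hb]

/-- With q the point of C nearest to x, going through y q gives ‖y x - p‖ ≤ (1 + lam L) ‖x - q‖ + c
‖q - p‖ ≤ c ‖x - p‖ + (c + 1 + lam L) dist(x, C). This is at most θ W(x) once θ ≥ c and θ K = c + 1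
+ lam L. -/
theorem exists_isConvexLyapunov {E : Type*} [NormedAddCommGroup E] [InnerProductSpace ℝ E]
    [FiniteDimensional ℝ E] {F : E → E} {g : E → EReal} {lam μ L : ℝ} (hL : 0 < L)
    (hg : IsProperLscConvex g) (hmono : StronglyMonotoneOn μ F (dom g)) (hLip : IsLipschitz L F)
    (hlam : lam ∈ Ioo (0 : ℝ) (2 * μ / L ^ 2)) {p : E} (hp : IsSolution F g p) :
    ∃ (W : E → ℝ) (ℓ M θ : ℝ), IsConvexLyapunov (proxStep F g lam) p W ℓ M θ := by
  set c := contractionFactor μ L lam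
  have hc0 : 0 ≤ c := contractionFactor_nonneg
  have hc1 : c < 1 := contractionFactor_lt_one hL hlam
  have hcl := hmono.on_closure hLip.continuous
  have hlam0 : 0 < lam := hlam.1
  set C := closure (dom g)
  have hpC : p ∈ C := subset_closure hp.1
  have hfix : proxStep F g lam p = p := (isSolution_iff_proxStep_eq hg hlam0).1 hp
  have hyC : ∀ x, proxStep F g lam x ∈ C := fun x =>
    subset_closure (isProxPoint_proxStep hg hlam0 x).1
  -- The value c itself may be 0, and `K` is obtained by dividing by `θ`.
  set θ := (1 + c) / 2
  have hθ0 : 0 < θ := by positivity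
  set K := (c + (1 + lam * L)) / θ
  have hK : 0 < K := by positivity
  have hθK : θ * K = c + (1 + lam * L) := mul_div_cancel₀ _ hθ0.ne'
  refine ⟨fun x => ‖x - p‖ + K * Metric.infDist x C, 1 + lam * L, 1 + K, θ,
    { ℓ_nonneg := by positivity
      M_pos := by positivity
      θ_lt_one := by simp only [θ]; linarith
      lipschitz_map := fun a b =>
        (norm_proxStep_sub_le hg hlam0 a b).trans (norm_forward_sub_le' hLip hlam0 a b)
      map_fixed := hfix
      norm_le := fun x => by
        have : 0 ≤ K * Metric.infDist x C := mul_nonneg hK.le Metric.infDist_nonneg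
        linarith
      fixed := by simp [Metric.infDist_zero_of_mem hpC]
      lipschitz := fun a b => ?_
      convexOn := ?_
      contracts := fun x => ?_ }⟩
  · have h1 : |‖a - p‖ - ‖b - p‖| ≤ ‖a - b‖ := by
      have := abs_norm_sub_norm_le (a - p) (b - p)
      rwa [sub_sub_sub_cancel_right] at this
    have h2 : |Metric.infDist a C - Metric.infDist b C| ≤ ‖a - b‖ := by
      have := (Metric.lipschitz_infDist_pt C).dist_le_mul a b
      rwa [Real.dist_eq, NNReal.coe_one, one_mul, dist_eq_norm] at this
    have e : ‖a - p‖ + K * Metric.infDist a C - (‖b - p‖ + K * Metric.infDist b C)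
        = (‖a - p‖ - ‖b - p‖) + K * (Metric.infDist a C - Metric.infDist b C) := by ring
    rw [e]
    refine (abs_add_le _ _).trans ?_
    rw [abs_mul, abs_of_pos hK]
    nlinarith
  · refine ConvexOn.add ?_ ?_
    · simpa [dist_eq_norm] using convexOn_univ_dist p
    · exact (convexOn_infDist hg.convex_dom.closure ⟨p, hpC⟩).smul hK.le
  · have h0 : Metric.infDist (proxStep F g lam x) C = 0 := Metric.infDist_zero_of_mem (hyC x)
    obtain ⟨q, hqC, hq⟩ := isClosed_closure.exists_infDist_eq_dist ⟨p, hpC⟩ x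
    change ‖proxStep F g lam x - p‖ + K * Metric.infDist (proxStep F g lam x) C
      ≤ θ * (‖x - p‖ + K * Metric.infDist x C)
    rw [h0, mul_zero, add_zero, hq, dist_eq_norm, mul_add, ← mul_assoc, hθK]
    have h1 : ‖proxStep F g lam x - proxStep F g lam q‖ ≤ (1 + lam * L) * ‖x - q‖ :=
      (norm_proxStep_sub_le hg hlam0 x q).trans (norm_forward_sub_le' hLip hlam0 x q)
    have h2 : ‖proxStep F g lam q - proxStep F g lam p‖ ≤ c * ‖q - p‖ :=
      (norm_proxStep_sub_le hg hlam0 q p).trans (norm_forward_sub_le hLip hcl hlam0 hqC hpC)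
    have h3 : ‖q - p‖ ≤ ‖x - q‖ + ‖x - p‖ := by
      rw [norm_sub_rev x q]; exact norm_sub_le_norm_sub_add_norm_sub q x p
    have h4 := norm_sub_le_norm_sub_add_norm_sub (proxStep F g lam x) (proxStep F g lam q)
      (proxStep F g lam p)
    rw [hfix] at h4 h2
    have h5 : c * ‖x - p‖ ≤ θ * ‖x - p‖ :=
      mul_le_mul_of_nonneg_right (by simp only [θ]; linarith) (norm_nonneg _)
    nlinarith [mul_le_mul_of_nonneg_left h3 hc0]

/-! ### Gains and truncated fields -/

/-- Scalar gains `σ` for which `x ↦ -σ(‖x - y x‖) (x - y x)` is continuous, and locally Lipschitz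
away from the fixed points of `y`. -/
structure IsGain (σ : ℝ → ℝ) : Prop where
  nonneg : ∀ r, 0 ≤ r → 0 ≤ σ r
  exists_lipschitzOnWith : ∀ a b, 0 < a → ∃ K : NNReal, LipschitzOnWith K σ (Icc a b)
  monotoneOn : MonotoneOn (fun r => r * σ r) (Ici 0)
  tendsto_zero : Tendsto (fun r => r * σ r) (𝓝[≥] 0) (𝓝 0)

theorem IsGain.continuousAt {σ : ℝ → ℝ} (hσ : IsGain σ) {r : ℝ} (hr : 0 < r) :
    ContinuousAt σ r := by
  obtain ⟨K, hK⟩ := hσ.exists_lipschitzOnWith (r / 2) (2 * r) (by positivity)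
  exact hK.continuousOn.continuousAt (Icc_mem_nhds (by linarith) (by linarith))

/-- The field `x ↦ -h(x) (x - y(x))`. -/
def scaledField {E : Type*} [NormedAddCommGroup E] [NormedSpace ℝ E] (h : E → ℝ) (y : E → E)
    (x : E) : E := -(h x • (x - y x))

/-- `h` agrees with the gain `σ` of the residual `‖x - y x‖` on the part of the ball of radius `R`
around `p` where the residual is at least `δ`. -/
structure IsTruncation {E : Type*} [NormedAddCommGroup E]
    (σ : ℝ → ℝ) (y : E → E) (p : E) (R δ : ℝ) (h : E → ℝ) : Prop where
  nonneg : ∀ x, 0 ≤ h x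
  eq : ∀ x, ‖x - p‖ ≤ R → δ ≤ ‖x - y x‖ → h x = σ ‖x - y x‖

/-- The original gain counts as a truncation, so that statements on pairs of truncations also
compare a truncated field with the original one. -/
theorem IsGain.isTruncation {E : Type*} [NormedAddCommGroup E] {σ : ℝ → ℝ} (hσ : IsGain σ)
    (y : E → E) (p : E) (R δ : ℝ) : IsTruncation σ y p R δ fun x => σ ‖x - y x‖ :=
  ⟨fun _ => hσ.nonneg _ (norm_nonneg _), fun _ _ _ => rfl⟩

theorem IsTruncation.mono {E : Type*} [NormedAddCommGroup E] {σ : ℝ → ℝ} {y : E → E} {p : E}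
    {R δ δ' : ℝ} {h : E → ℝ} (hh : IsTruncation σ y p R δ h) (hδ : δ ≤ δ') :
    IsTruncation σ y p R δ' h :=
  ⟨hh.nonneg, fun x hx hx' => hh.eq x hx (hδ.trans hx')⟩

/-- `φ` solves `φ' = v(φ)` on `[0, T]` in the sense of right derivatives. -/
structure IsForwardSolution {E : Type*} [NormedAddCommGroup E] [NormedSpace ℝ E]
    (v : E → E) (φ : ℝ → E) (T : ℝ) : Prop where
  continuousOn : ContinuousOn φ (Icc 0 T)
  hasDeriv : ∀ t ∈ Ico 0 T, HasDerivWithinAt φ (v (φ t)) (Ici t) t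

theorem IsForwardSolution.mono {E : Type*} [NormedAddCommGroup E] [NormedSpace ℝ E]
    {v : E → E} {φ : ℝ → E} {T T' : ℝ} (hφ : IsForwardSolution v φ T) (h : T' ≤ T) :
    IsForwardSolution v φ T' :=
  ⟨hφ.continuousOn.mono (Icc_subset_Icc_right h),
    fun t ht => hφ.hasDeriv t (Ico_subset_Ico_right h ht)⟩

theorem IsTrajectoryOn.isForwardSolution {E : Type*} [NormedAddCommGroup E]
    [InnerProductSpace ℝ E] {v : E → E} {x₀ : E} {I : Set ℝ} {φ : ℝ → E} {T : ℝ}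
    (hφ : IsTrajectoryOn v x₀ I φ) (hT : Icc 0 T ⊆ I) : IsForwardSolution v φ T where
  continuousOn := fun t ht => ((hφ.2 t (hT ht)).mono hT).continuousWithinAt
  hasDeriv := fun t ht => ((hφ.2 t (hT (Ico_subset_Icc_self ht))).mono hT).mono_of_mem_nhdsWithin
    (mem_of_superset (Icc_mem_nhdsGE ht.2) (Icc_subset_Icc_left ht.1))

/-! ### Decay of `W` along the flow, truncated fields, forward uniqueness. -/

section

variable {E : Type*} [NormedAddCommGroup E] [NormedSpace ℝ E]
  {σ : ℝ → ℝ} {y : E → E} {p : E} {W : E → ℝ} {ℓ M θ R δ : ℝ}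

namespace IsConvexLyapunov

theorem nonneg (hW : IsConvexLyapunov y p W ℓ M θ) (x : E) : 0 ≤ W x :=
  (norm_nonneg _).trans (hW.norm_le x)

theorem eq_zero_iff (hW : IsConvexLyapunov y p W ℓ M θ) {x : E} : W x = 0 ↔ x = p := by
  refine ⟨fun h => ?_, fun h => h ▸ hW.fixed⟩
  have := hW.norm_le x
  rw [h] at this
  exact sub_eq_zero.1 (norm_le_zero_iff.1 this)

theorem pos (hW : IsConvexLyapunov y p W ℓ M θ) {x : E} (hx : x ≠ p) : 0 < W x :=
  (hW.nonneg x).lt_of_ne fun h => hx (hW.eq_zero_iff.1 h.symm)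

theorem continuous (hW : IsConvexLyapunov y p W ℓ M θ) : Continuous W :=
  (LipschitzWith.of_dist_le' (K := M) fun a b => by
    rw [Real.dist_eq, dist_eq_norm]; exact hW.lipschitz a b).continuous

theorem le_mul_norm (hW : IsConvexLyapunov y p W ℓ M θ) (x : E) : W x ≤ M * ‖x - p‖ := by
  have := (le_abs_self _).trans (hW.lipschitz x p)
  rwa [hW.fixed, sub_zero] at this

theorem norm_residual_sub_le (hW : IsConvexLyapunov y p W ℓ M θ) (a b : E) :
    ‖(a - y a) - (b - y b)‖ ≤ (1 + ℓ) * ‖a - b‖ := by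
  rw [sub_sub_sub_comm]
  refine (norm_sub_le _ _).trans ?_
  have := hW.lipschitz_map a b
  linarith

theorem norm_residual_le (hW : IsConvexLyapunov y p W ℓ M θ) (x : E) :
    ‖x - y x‖ ≤ (1 + ℓ) * ‖x - p‖ := by
  have := hW.norm_residual_sub_le x p
  rwa [hW.map_fixed, sub_self, sub_zero] at this

theorem continuous_residual (hW : IsConvexLyapunov y p W ℓ M θ) :
    Continuous fun x => x - y x :=
  (LipschitzWith.of_dist_le' (K := 1 + ℓ) fun a b => by
    rw [dist_eq_norm, dist_eq_norm]; exact hW.norm_residual_sub_le a b).continuous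

/-- From W(x) ≤ W(y x) + M ‖x - y x‖ ≤ θ W(x) + M ‖x - y x‖. A lower bound on `W` thus keeps the
residual away from 0. -/
theorem le_mul_norm_residual (hW : IsConvexLyapunov y p W ℓ M θ) (x : E) :
    W x ≤ M / (1 - θ) * ‖x - y x‖ := by
  have h1 := (le_abs_self _).trans (hW.lipschitz x (y x))
  have h2 := hW.contracts x
  have h3 : 0 < 1 - θ := by linarith [hW.θ_lt_one]
  rw [div_mul_eq_mul_div, le_div_iff₀ h3]
  linarith

theorem factor_pos (hW : IsConvexLyapunov y p W ℓ M θ) : 0 < M / (1 - θ) :=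
  div_pos hW.M_pos (by linarith [hW.θ_lt_one])

/-- The upper right Dini derivative of `W` along an averaging flow. -/
theorem slope_lt (hW : IsConvexLyapunov y p W ℓ M θ) {φ : ℝ → E} {s t r : ℝ} (hs : 0 ≤ s)
    (hφ : HasDerivWithinAt φ (-(s • (φ t - y (φ t)))) (Ici t) t)
    (hr : -(s * (1 - θ) * W (φ t)) < r) : ∀ᶠ z in 𝓝[>] t, slope (W ∘ φ) t z < r := by
  set x := φ t with hx
  set ε := (r + s * (1 - θ) * W x) / (2 * M) with hε
  have hM := hW.M_pos
  have hε0 : 0 < ε := div_pos (by linarith) (by positivity)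
  have hMε : M * ε < r + s * (1 - θ) * W x := by
    rw [hε]; field_simp; linarith
  have ho := (hasDerivWithinAt_iff_isLittleO.1 hφ).def hε0
  have ho' : ∀ᶠ z in 𝓝[>] t,
      ‖φ z - φ t - (z - t) • -(s • (φ t - y (φ t)))‖ ≤ ε * ‖z - t‖ :=
    ho.filter_mono (nhdsWithin_mono _ Ioi_subset_Ici_self)
  -- For such z the Euler step x - τ s (x - y x) is a convex combination of x and y x, so convexity
  -- of `W` applies. The summand 1 covers s = 0.
  have hsmall : ∀ᶠ z in 𝓝[>] t, z < t + (s + 1)⁻¹ :=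
    (eventually_lt_nhds (by linarith [inv_pos.2 (by linarith : 0 < s + 1)])).filter_mono
      nhdsWithin_le_nhds
  filter_upwards [ho', hsmall, self_mem_nhdsWithin] with z hz hz1 hz0
  have hτ : 0 < z - t := sub_pos.2 hz0
  set τ := z - t
  have hτs : τ * s ≤ 1 := by
    have h1 : τ ≤ (s + 1)⁻¹ := by simp only [τ]; linarith
    calc τ * s ≤ (s + 1)⁻¹ * (s + 1) := by gcongr; linarith
      _ = 1 := inv_mul_cancel₀ (by linarith)
  have hτs0 : 0 ≤ τ * s := by positivity
  have hconv := hW.convexOn.2 (mem_univ x) (mem_univ (y x)) (sub_nonneg.2 hτs) hτs0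
    (sub_add_cancel 1 (τ * s))
  have hlip := (le_abs_self _).trans
    (hW.lipschitz (φ z) ((1 - τ * s) • x + (τ * s) • y x))
  rw [show φ z - ((1 - τ * s) • x + (τ * s) • y x)
    = φ z - φ t - τ • -(s • (φ t - y (φ t))) by rw [← hx]; module] at hlip
  rw [Real.norm_of_nonneg hτ.le] at hz
  rw [smul_eq_mul, smul_eq_mul] at hconv
  have hc := mul_le_mul_of_nonneg_left (hW.contracts x) (by positivity : 0 ≤ τ * s)
  have hz' := mul_le_mul_of_nonneg_left hz hM.le
  rw [slope_def_field, div_lt_iff₀ hτ]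
  change W (φ z) - W x < r * τ
  have := mul_lt_mul_of_pos_right hMε hτ
  nlinarith

theorem antitoneOn_comp (hW : IsConvexLyapunov y p W ℓ M θ) {φ : ℝ → E} {T : ℝ} {h : E → ℝ}
    (hh : ∀ x, 0 ≤ h x) (hφ : IsForwardSolution (scaledField h y) φ T) :
    AntitoneOn (W ∘ φ) (Icc 0 T) := by
  intro a ha b hb hab
  refine image_le_of_liminf_slope_right_le_deriv_boundary (f := W ∘ φ) (a := a) (b := b)
    (B := fun _ => (W ∘ φ) a) (B' := fun _ => 0)
    (hW.continuous.comp_continuousOn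
      (hφ.continuousOn.mono (Icc_subset_Icc ha.1 hb.2))) le_rfl continuousOn_const
    (fun _ _ => hasDerivWithinAt_const _ _ _) (fun t ht r hr => ?_) ⟨hab, le_rfl⟩
  refine (hW.slope_lt (hh (φ t)) (hφ.hasDeriv t ⟨ha.1.trans ht.1, ht.2.trans_le hb.2⟩)
    (lt_of_le_of_lt ?_ hr)).frequently
  have := mul_nonneg (mul_nonneg (hh (φ t)) (by linarith [hW.θ_lt_one] : 0 ≤ 1 - θ))
    (hW.nonneg (φ t))
  linarith

theorem le_initial (hW : IsConvexLyapunov y p W ℓ M θ) {φ : ℝ → E} {T : ℝ} {h : E → ℝ}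
    (hh : ∀ x, 0 ≤ h x) (hφ : IsForwardSolution (scaledField h y) φ T) {t : ℝ}
    (ht : t ∈ Icc 0 T) : W (φ t) ≤ W (φ 0) :=
  hW.antitoneOn_comp hh hφ ⟨le_rfl, ht.1.trans ht.2⟩ ht ht.1

/-- As long as `W` is bounded below, solutions do not see the truncation. -/
theorem isForwardSolution_congr (hW : IsConvexLyapunov y p W ℓ M θ) {φ : ℝ → E} {T : ℝ}
    {h h' : E → ℝ} (hh : IsTruncation σ y p R δ h) (hh' : IsTruncation σ y p R δ h')
    (hφ : IsForwardSolution (scaledField h y) φ T) (h0 : W (φ 0) ≤ R)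
    (hT : M / (1 - θ) * δ ≤ W (φ T)) : IsForwardSolution (scaledField h' y) φ T := by
  refine ⟨hφ.continuousOn, fun t ht => ?_⟩
  have ht' := Ico_subset_Icc_self ht
  have h1 : ‖φ t - p‖ ≤ R :=
    (hW.norm_le _).trans ((hW.le_initial hh.nonneg hφ ht').trans h0)
  have h2 : δ ≤ ‖φ t - y (φ t)‖ := by
    have h3 := hW.antitoneOn_comp hh.nonneg hφ ht' ⟨ht.1.trans ht.2.le, le_rfl⟩ ht.2.le
    exact le_of_mul_le_mul_left (hT.trans (h3.trans (hW.le_mul_norm_residual _))) hW.factor_pos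
  have h4 := hφ.hasDeriv t ht
  rw [scaledField, hh.eq _ h1 h2, ← hh'.eq _ h1 h2] at h4
  exact h4

/-- Clamp the residual to [δ, b], where σ is Lipschitz, then multiply by a cutoff vanishing outside
the ball of radius R + 1. The last clause serves to estimate the error made at small residuals. -/
theorem exists_truncation (hW : IsConvexLyapunov y p W ℓ M θ) (hσ : IsGain σ) (R : ℝ)
    (hδ : 0 < δ) : ∃ h : E → ℝ, IsTruncation σ y p R δ h ∧
      (∃ K : NNReal, LipschitzWith K (scaledField h y)) ∧
      (∃ B : NNReal, ∀ x, ‖scaledField h y x‖ ≤ B) ∧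
      ∀ x, ‖x - p‖ ≤ R → ‖x - y x‖ ≤ δ → h x = σ δ := by
  -- Residuals on the ball of radius `R` are at most `b`, so the upper clamp changes nothing there.
  set b := max δ ((1 + ℓ) * R)
  have hℓ := hW.ℓ_nonneg
  obtain ⟨K, hK⟩ := hσ.exists_lipschitzOnWith δ b hδ
  have hδb : δ ≤ b := le_max_left _ _
  set cl : ℝ → ℝ := fun r => max (min b r) δ
  have hcl : ∀ r, cl r ∈ Icc δ b := fun r => ⟨le_max_right _ _, max_le (min_le_left _ _) hδb⟩
  have hcllip : ∀ r s, |cl r - cl s| ≤ |r - s| := fun r s => by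
    refine (abs_max_sub_max_le_abs _ _ _).trans ((abs_min_sub_min_le_max _ _ _ _).trans ?_)
    simp
  have hσlip : ∀ r ∈ Icc δ b, ∀ s ∈ Icc δ b, |σ r - σ s| ≤ K * |r - s| := fun r hr s hs => by
    have := hK.dist_le_mul r hr s hs
    rwa [Real.dist_eq, Real.dist_eq] at this
  set u : E → ℝ := fun x => σ (cl ‖x - y x‖)
  have hu0 : ∀ x, 0 ≤ u x := fun x => hσ.nonneg _ (hδ.le.trans (hcl _).1)
  set S := σ δ + K * (b - δ)
  have huS : ∀ x, u x ≤ S := fun x => by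
    have h1 := (le_abs_self _).trans (hσlip _ (hcl ‖x - y x‖) δ ⟨le_rfl, hδb⟩)
    rw [abs_of_nonneg (sub_nonneg.2 (hcl _).1)] at h1
    have h2 : (K : ℝ) * (cl ‖x - y x‖ - δ) ≤ K * (b - δ) := by
      gcongr
      exact (hcl _).2
    simp only [u, S]
    linarith
  have hS : 0 ≤ S := (hu0 p).trans (huS p)
  have hulip : ∀ a c, |u a - u c| ≤ K * ((1 + ℓ) * ‖a - c‖) := fun a c => by
    refine (hσlip _ (hcl _) _ (hcl _)).trans ?_
    gcongr
    exact (hcllip _ _).trans ((abs_norm_sub_norm_le _ _).trans (hW.norm_residual_sub_le a c))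
  set χ : E → ℝ := fun x => max (min 1 (R + 1 - ‖x - p‖)) 0
  have hχ0 : ∀ x, 0 ≤ χ x := fun x => le_max_right _ _
  have hχ1 : ∀ x, χ x ≤ 1 := fun x => max_le (min_le_left _ _) zero_le_one
  have hχlip : ∀ a c, |χ a - χ c| ≤ ‖a - c‖ := fun a c => by
    refine (abs_max_sub_max_le_abs _ _ _).trans ((abs_min_sub_min_le_max _ _ _ _).trans ?_)
    rw [sub_self, abs_zero, max_eq_right (abs_nonneg _), sub_sub_sub_cancel_left, abs_sub_comm]
    have := abs_norm_sub_norm_le (a - p) (c - p)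
    rwa [sub_sub_sub_cancel_right] at this
  have hχout : ∀ x, R + 1 < ‖x - p‖ → χ x = 0 := fun x hx =>
    max_eq_right ((min_le_right _ _).trans (by linarith))
  have hχin : ∀ x, ‖x - p‖ ≤ R → χ x = 1 := fun x hx => by
    simp only [χ]
    rw [min_eq_left (by linarith), max_eq_left zero_le_one]
  set h : E → ℝ := fun x => u x * χ x
  have hh0 : ∀ x, 0 ≤ h x := fun x => mul_nonneg (hu0 x) (hχ0 x)
  have hhS : ∀ x, h x ≤ S := fun x =>
    (mul_le_of_le_one_right (hu0 x) (hχ1 x)).trans (huS x)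
  set H := K * (1 + ℓ) + S
  have hH : 0 ≤ H := by positivity
  have hhlip : ∀ a c, |h a - h c| ≤ H * ‖a - c‖ := fun a c => by
    have e : h a - h c = (u a - u c) * χ a + u c * (χ a - χ c) := by simp only [h]; ring
    rw [e]
    refine (abs_add_le _ _).trans ?_
    rw [abs_mul, abs_mul, abs_of_nonneg (hχ0 a), abs_of_nonneg (hu0 c)]
    have h1 := mul_le_mul (hulip a c) (hχ1 a) (hχ0 a) (by positivity)
    have h2 := mul_le_mul (huS c) (hχlip a c) (abs_nonneg _) hS
    simp only [H]
    linarith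
  set D := (1 + ℓ) * max (R + 1) 0
  have hD : 0 ≤ D := by positivity
  have hres : ∀ x, ‖x - p‖ ≤ R + 1 → ‖x - y x‖ ≤ D := fun x hx =>
    (hW.norm_residual_le x).trans (mul_le_mul_of_nonneg_left (hx.trans (le_max_left _ _))
      (by positivity))
  set N := H * D + S * (1 + ℓ)
  -- Only one of the points has to lie in the ball where residuals are bounded; if both lie outside,
  -- the field vanishes at both.
  have key : ∀ a c, ‖a - p‖ ≤ R + 1 →
      ‖scaledField h y a - scaledField h y c‖ ≤ N * ‖a - c‖ := fun a c ha => by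
    have e : scaledField h y a - scaledField h y c
        = -((h a - h c) • (a - y a) + h c • ((a - y a) - (c - y c))) := by
      simp only [scaledField]; module
    rw [e, norm_neg]
    refine (norm_add_le _ _).trans ?_
    rw [norm_smul, norm_smul, Real.norm_eq_abs, Real.norm_of_nonneg (hh0 c)]
    have h1 := mul_le_mul (hhlip a c) (hres a ha) (norm_nonneg _) (by positivity)
    have h2 := mul_le_mul (hhS c) (hW.norm_residual_sub_le a c) (norm_nonneg _) hS
    simp only [N]
    linarith
  have hzero : ∀ x, R + 1 < ‖x - p‖ → scaledField h y x = 0 := fun x hx => by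
    simp [scaledField, h, hχout x hx]
  refine ⟨h, ⟨hh0, fun x hx hx' => ?_⟩, ⟨N.toNNReal, ?_⟩, ⟨(S * D).toNNReal, fun x => ?_⟩,
    fun x hx hx' => ?_⟩
  · have hb : ‖x - y x‖ ≤ b := ((hW.norm_residual_le x).trans
      (mul_le_mul_of_nonneg_left hx (by positivity))).trans (le_max_right _ _)
    simp only [h, u, cl]
    rw [hχin x hx, mul_one, min_eq_right hb, max_eq_left hx']
  · refine LipschitzWith.of_dist_le' fun a c => ?_
    rw [dist_eq_norm, dist_eq_norm]
    rcases le_or_gt ‖a - p‖ (R + 1) with ha | ha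
    · exact key a c ha
    rcases le_or_gt ‖c - p‖ (R + 1) with hc | hc
    · rw [norm_sub_rev, norm_sub_rev a]
      exact key c a hc
    · rw [hzero a ha, hzero c hc, sub_self, norm_zero]
      positivity
  · refine le_trans ?_ (Real.le_coe_toNNReal _)
    rcases le_or_gt ‖x - p‖ (R + 1) with hx | hx
    · rw [scaledField, norm_neg, norm_smul, Real.norm_of_nonneg (hh0 x)]
      exact mul_le_mul (hhS x) (hres x hx) (norm_nonneg _) hS
    · rw [hzero x hx, norm_zero]
      positivity
  · simp only [h, u, cl]
    rw [hχin x hx, mul_one, max_eq_right ((min_le_right _ _).trans hx')]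

/-- Forward uniqueness for the untruncated field. -/
theorem eq_of_ne (hW : IsConvexLyapunov y p W ℓ M θ) (hσ : IsGain σ) {φ ψ : ℝ → E} {T : ℝ}
    (hT : 0 ≤ T) (hφ : IsForwardSolution (scaledField (fun x => σ ‖x - y x‖) y) φ T)
    (hψ : IsForwardSolution (scaledField (fun x => σ ‖x - y x‖) y) ψ T) (h0 : φ 0 = ψ 0)
    (hφT : φ T ≠ p) (hψT : ψ T ≠ p) : φ T = ψ T := by
  -- With this `δ` neither solution meets the truncation up to time T, so both solve one Lipschitz
  -- equation.
  set δ := min (W (φ T)) (W (ψ T)) / (M / (1 - θ))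
  have hD := hW.factor_pos
  have hδ : 0 < δ := div_pos (lt_min (hW.pos hφT) (hW.pos hψT)) hD
  have hDδ : M / (1 - θ) * δ = min (W (φ T)) (W (ψ T)) := mul_div_cancel₀ _ hD.ne'
  obtain ⟨h, hh, ⟨K, hK⟩, -, -⟩ := hW.exists_truncation hσ (W (φ 0)) hδ
  have hX := hσ.isTruncation y p (W (φ 0)) δ
  have hφ' := hW.isForwardSolution_congr hX hh hφ le_rfl (hDδ.le.trans (min_le_left _ _))
  have hψ' := hW.isForwardSolution_congr hX hh hψ (by rw [h0])
    (hDδ.le.trans (min_le_right _ _))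
  exact ODE_solution_unique (v := fun _ => scaledField h y) (fun _ => hK) hφ'.continuousOn
    hφ'.hasDeriv hψ'.continuousOn hψ'.hasDeriv h0 ⟨hT, le_rfl⟩

/-- Otherwise W ∘ φ takes the value W(ψ T) / 2 at some time t. Neither solution is at p then, so
they agree at t, against W(ψ t) ≥ W(ψ T). -/
theorem eq_target_of_eq (hW : IsConvexLyapunov y p W ℓ M θ) (hσ : IsGain σ) {φ ψ : ℝ → E} {T : ℝ}
    (hT : 0 ≤ T) (hφ : IsForwardSolution (scaledField (fun x => σ ‖x - y x‖) y) φ T)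
    (hψ : IsForwardSolution (scaledField (fun x => σ ‖x - y x‖) y) ψ T) (h0 : φ 0 = ψ 0)
    (hφT : φ T = p) : ψ T = p := by
  by_contra hψT
  have hc := hW.pos hψT
  have hnn := (hσ.isTruncation y p 0 0).nonneg
  have hivt := intermediate_value_Icc' hT (hW.continuous.comp_continuousOn hφ.continuousOn)
  have hle := hW.le_initial hnn hψ ⟨hT, le_rfl⟩
  obtain ⟨t, ht, hWt⟩ := hivt (show W (ψ T) / 2 ∈ Icc ((W ∘ φ) T) ((W ∘ φ) 0) by
    simp only [Function.comp_apply, hφT, hW.fixed, h0]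
    constructor <;> linarith)
  simp only [Function.comp_apply] at hWt
  have hψt : W (ψ T) ≤ W (ψ t) := hW.antitoneOn_comp hnn hψ ht ⟨hT, le_rfl⟩ ht.2
  have heq := hW.eq_of_ne hσ ht.1 (hφ.mono ht.2) (hψ.mono ht.2) h0
    (fun h => by rw [h, hW.fixed] at hWt; linarith)
    (fun h => by rw [h, hW.fixed] at hψt; linarith)
  rw [heq] at hWt
  linarith

theorem forward_unique (hW : IsConvexLyapunov y p W ℓ M θ) (hσ : IsGain σ) {φ ψ : ℝ → E} {T : ℝ}
    (hT : 0 ≤ T) (hφ : IsForwardSolution (scaledField (fun x => σ ‖x - y x‖) y) φ T)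
    (hψ : IsForwardSolution (scaledField (fun x => σ ‖x - y x‖) y) ψ T) (h0 : φ 0 = ψ 0) :
    φ T = ψ T := by
  by_cases hφT : φ T = p
  · rw [hφT, hW.eq_target_of_eq hσ hT hφ hψ h0 hφT]
  by_cases hψT : ψ T = p
  · rw [hψT, hW.eq_target_of_eq hσ hT hψ hφ h0.symm hψT]
  exact hW.eq_of_ne hσ hT hφ hψ h0 hφT hψT

/-- At a fixed point of y the gain may blow up, but the norm of the field is r σ(r) with r → 0. -/
theorem continuous_scaledField (hW : IsConvexLyapunov y p W ℓ M θ) (hσ : IsGain σ) :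
    Continuous (scaledField (fun x => σ ‖x - y x‖) y) := by
  refine continuous_iff_continuousAt.2 fun x => ?_
  have hres := hW.continuous_residual
  by_cases hx : y x = x
  · have hz : scaledField (fun x => σ ‖x - y x‖) y x = 0 := by
      rw [scaledField, hx, sub_self, smul_zero, neg_zero]
    rw [ContinuousAt, hz, tendsto_zero_iff_norm_tendsto_zero]
    have hnorm : ∀ z, ‖scaledField (fun x => σ ‖x - y x‖) y z‖ = ‖z - y z‖ * σ ‖z - y z‖ :=
      fun z => by
        rw [scaledField, norm_neg, norm_smul, mul_comm,
          Real.norm_of_nonneg (hσ.nonneg _ (norm_nonneg _))]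
    simp only [hnorm]
    refine hσ.tendsto_zero.comp (tendsto_nhdsWithin_iff.2 ⟨?_, .of_forall fun z =>
      norm_nonneg (z - y z)⟩)
    exact hres.norm.tendsto' x 0 (by rw [hx, sub_self, norm_zero])
  · have hpos : 0 < ‖x - y x‖ := norm_pos_iff.2 (sub_ne_zero.2 (Ne.symm hx))
    exact ((ContinuousAt.comp (f := fun x => ‖x - y x‖) (hσ.continuousAt hpos)
      hres.norm.continuousAt).smul hres.continuousAt).neg

end IsConvexLyapunov

end

/-! ### Existence of solutions as limits of truncated flows. -/

section

variable {E : Type*} [NormedAddCommGroup E] [NormedSpace ℝ E]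
  {σ : ℝ → ℝ} {y : E → E} {p : E} {W : E → ℝ} {ℓ M θ : ℝ}

/-- Bounded globally Lipschitz fields have solutions on every compact time interval. -/
theorem exists_isForwardSolution_of_lipschitzWith [CompleteSpace E] {v : E → E} {K B : NNReal}
    (hv : LipschitzWith K v) (hB : ∀ x, ‖v x‖ ≤ B) (x₀ : E) {T : ℝ} (hT : 0 ≤ T) :
    ∃ φ : ℝ → E, φ 0 = x₀ ∧ IsForwardSolution v φ T := by
  -- A curve of speed at most B stays within B T of `x₀`, so this radius allows the whole interval.
  have hPL : IsPicardLindelof (fun _ => v) (⟨0, le_rfl, hT⟩ : Icc 0 T) x₀ (B * T.toNNReal) 0 B K :=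
    IsPicardLindelof.of_time_independent (fun x _ => hB x) hv.lipschitzOnWith (by
      simp [Real.coe_toNNReal T hT, hT])
  obtain ⟨φ, h0, hφ⟩ := hPL.exists_eq_forall_mem_Icc_hasDerivWithinAt₀
  refine ⟨φ, h0, fun t ht => (hφ t ht).continuousWithinAt, fun t ht => ?_⟩
  exact (hφ t (Ico_subset_Icc_self ht)).mono_of_mem_nhdsWithin
    (mem_of_superset (Icc_mem_nhdsGE ht.2) (Icc_subset_Icc_left ht.1))

namespace IsConvexLyapunov

/-- Solutions of two truncated fields stay close to each other. -/
theorem norm_sub_le_of_truncations (hW : IsConvexLyapunov y p W ℓ M θ) {h h' : E → ℝ}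
    {K K' : NNReal} {δ R T : ℝ} (hh : IsTruncation σ y p R δ h) (hh' : IsTruncation σ y p R δ h')
    (hK : LipschitzWith K (scaledField h y)) (hK' : LipschitzWith K' (scaledField h' y))
    {φ ψ : ℝ → E} (hT : 0 ≤ T) (hφ : IsForwardSolution (scaledField h y) φ T)
    (hψ : IsForwardSolution (scaledField h' y) ψ T) (h0 : φ 0 = ψ 0) (hR : W (φ 0) ≤ R)
    (hδ : 0 ≤ δ) : ‖φ T - ψ T‖ ≤ 2 * (M / (1 - θ)) * δ := by
  have hD := hW.factor_pos
  -- A solution still above the threshold at T solves both truncated equations, hence equals the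
  -- other; if both are below it, both are close to p.
  rcases le_or_gt (M / (1 - θ) * δ) (W (φ T)) with h1 | h1
  · have hφ' := hW.isForwardSolution_congr hh hh' hφ hR h1
    rw [ODE_solution_unique (v := fun _ => scaledField h' y) (fun _ => hK') hφ'.continuousOn
      hφ'.hasDeriv hψ.continuousOn hψ.hasDeriv h0 ⟨hT, le_rfl⟩, sub_self, norm_zero]
    positivity
  rcases le_or_gt (M / (1 - θ) * δ) (W (ψ T)) with h2 | h2
  · have hψ' := hW.isForwardSolution_congr hh' hh hψ (by rwa [← h0]) h2
    rw [ODE_solution_unique (v := fun _ => scaledField h y) (fun _ => hK) hφ.continuousOn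
      hφ.hasDeriv hψ'.continuousOn hψ'.hasDeriv h0 ⟨hT, le_rfl⟩, sub_self, norm_zero]
    positivity
  have h3 := norm_sub_le (φ T - p) (ψ T - p)
  rw [sub_sub_sub_cancel_right] at h3
  linarith [hW.norm_le (φ T), hW.norm_le (ψ T)]

/-- The truncated solutions are uniformly Cauchy as δ → 0; the integral equation passes to the limit
by dominated convergence and is then differentiated. -/
theorem exists_solution_Icc [CompleteSpace E] (hW : IsConvexLyapunov y p W ℓ M θ) (hσ : IsGain σ) (x₀ : E) {T : ℝ}
    (hT : 0 ≤ T) : ∃ φ : ℝ → E, φ 0 = x₀ ∧ ∀ t ∈ Icc 0 T,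
      HasDerivWithinAt φ (scaledField (fun x => σ ‖x - y x‖) y (φ t)) (Icc 0 T) t := by
  set X := scaledField (fun x => σ ‖x - y x‖) y with hX
  have hXc : Continuous X := hW.continuous_scaledField hσ
  set R := W x₀
  set δ : ℕ → ℝ := fun n => 1 / ((n : ℝ) + 1)
  have hδ : ∀ n, 0 < δ n := fun n => Nat.one_div_pos_of_nat
  have hδ0 : Tendsto δ atTop (𝓝 0) := tendsto_one_div_add_atTop_nhds_zero_nat
  have hδanti : Antitone δ := fun m n hmn => Nat.one_div_le_one_div hmn
  choose h hh hlip hbd hflat using fun n => hW.exists_truncation hσ R (hδ n)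
  choose K hK using hlip
  choose B hB using hbd
  choose φ hφ0 hφ using fun n => exists_isForwardSolution_of_lipschitzWith (hK n) (hB n) x₀ hT
  have hφR : ∀ n, ∀ t ∈ Icc 0 T, ‖φ n t - p‖ ≤ R := fun n t ht => by
    have := (hW.norm_le _).trans (hW.le_initial (hh n).nonneg (hφ n) ht)
    rwa [hφ0] at this
  set D := 2 * (M / (1 - θ))
  have hD : 0 < D := mul_pos two_pos hW.factor_pos
  have hclose : ∀ N n m, N ≤ n → N ≤ m → ∀ t ∈ Icc 0 T, ‖φ n t - φ m t‖ ≤ D * δ N :=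
    fun N n m hn hm t ht => hW.norm_sub_le_of_truncations ((hh n).mono (hδanti hn))
      ((hh m).mono (hδanti hm)) (hK n) (hK m) ht.1 ((hφ n).mono ht.2) ((hφ m).mono ht.2)
      (by rw [hφ0, hφ0]) (by rw [hφ0]) (hδ N).le
  -- the limit, extended by constants outside `[0, T]`
  set ψ : ℕ → ℝ → E := fun n => IccExtend hT ((Icc 0 T).domRestrict (φ n))
  have hψeq : ∀ n, ∀ t ∈ Icc 0 T, ψ n t = φ n t := fun n t ht => by
    simp only [ψ]
    rw [IccExtend_of_mem _ _ ht, domRestrict_apply]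
  have hψmem : ∀ n t, ψ n t = φ n (projIcc 0 T hT t) := fun n t => rfl
  have hψc : ∀ n, Continuous (ψ n) := fun n =>
    (continuousOn_iff_continuous_domRestrict.1 (hφ n).continuousOn).Icc_extend'
  have hψR : ∀ n t, ‖ψ n t - p‖ ≤ R := fun n t => hφR n _ (projIcc 0 T hT t).2
  have hψclose : ∀ N n m, N ≤ n → N ≤ m → ∀ t, ‖ψ n t - ψ m t‖ ≤ D * δ N :=
    fun N n m hn hm t => hclose N n m hn hm _ (projIcc 0 T hT t).2
  have hDδ0 : Tendsto (fun n => D * δ n) atTop (𝓝 0) := by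
    simpa using hδ0.const_mul D
  have hcauchy : ∀ t, CauchySeq fun n => ψ n t := fun t =>
    cauchySeq_of_le_tendsto_0 (fun n => D * δ n)
      (fun n m N hn hm => by rw [dist_eq_norm]; exact hψclose N n m hn hm t) hDδ0
  choose f hf using fun t => cauchySeq_tendsto_of_complete (hcauchy t)
  have hψf : ∀ n t, ‖ψ n t - f t‖ ≤ D * δ n := fun n t =>
    le_of_tendsto (tendsto_const_nhds.sub (hf t)).norm (by
      filter_upwards [eventually_ge_atTop n] with m hm using hψclose n n m le_rfl hm t)
  have hunif : TendstoUniformly ψ f atTop := by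
    rw [Metric.tendstoUniformly_iff]
    intro ε hε
    filter_upwards [hDδ0.eventually (gt_mem_nhds hε)] with n hn t
    rw [dist_comm, dist_eq_norm]
    exact (hψf n t).trans_lt hn
  have hfc : Continuous f := hunif.continuous (.of_forall hψc)
  -- the truncated fields converge uniformly
  have hdiff : ∀ n x, ‖x - p‖ ≤ R → ‖scaledField (h n) y x - X x‖ ≤ 2 * (δ n * σ (δ n)) := by
    intro n x hx
    rcases le_or_gt (δ n) ‖x - y x‖ with h1 | h1
    · rw [hX, scaledField, scaledField, (hh n).eq x hx h1, sub_self, norm_zero]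
      have := hσ.nonneg _ (hδ n).le
      have := (hδ n).le
      positivity
    · refine (norm_sub_le _ _).trans ?_
      rw [hX, scaledField, scaledField, norm_neg, norm_neg, norm_smul, norm_smul,
        hflat n x hx h1.le, Real.norm_of_nonneg (hσ.nonneg _ (hδ n).le),
        Real.norm_of_nonneg (hσ.nonneg _ (norm_nonneg _))]
      have h2 := hσ.monotoneOn (norm_nonneg (x - y x)) (hδ n).le h1.le
      have h3 := mul_le_mul_of_nonneg_left h1.le (hσ.nonneg _ (hδ n).le)
      simp only at h2
      linarith
  have hη0 : Tendsto (fun n => 2 * (δ n * σ (δ n))) atTop (𝓝 0) := by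
    have := hσ.tendsto_zero.comp (tendsto_nhdsWithin_iff.2 ⟨hδ0, .of_forall fun n => (hδ n).le⟩)
    simpa using this.const_mul 2
  have hfield : ∀ t, Tendsto (fun n => scaledField (h n) y (ψ n t)) atTop (𝓝 (X (f t))) := by
    intro t
    have h1 : Tendsto (fun n => X (ψ n t)) atTop (𝓝 (X (f t))) :=
      (hXc.tendsto _).comp (hf t)
    have h2 : Tendsto (fun n => scaledField (h n) y (ψ n t) - X (ψ n t)) atTop (𝓝 0) :=
      squeeze_zero_norm (fun n => hdiff n _ (hψR n t)) hη0
    simpa using h2.add h1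
  -- The first summand bounds the truncation error, as δ n ≤ 1; the second bounds `X` on the ball,
  -- as r σ(r) is monotone.
  have hbound : ∀ n t, ‖scaledField (h n) y (ψ n t)‖
      ≤ 2 * (1 * σ 1) + (1 + ℓ) * R * σ ((1 + ℓ) * R) := by
    intro n t
    have hδ1 : δ n ≤ 1 := by
      have := hδanti (Nat.zero_le n)
      simpa [δ] using this
    have h1 := hdiff n _ (hψR n t)
    have h2 := hσ.monotoneOn (hδ n).le (zero_le_one (α := ℝ)) hδ1
    have h4 : ‖ψ n t - y (ψ n t)‖ ≤ (1 + ℓ) * R := (hW.norm_residual_le _).trans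
      (mul_le_mul_of_nonneg_left (hψR n t) (by linarith [hW.ℓ_nonneg]))
    have h5 := hσ.monotoneOn (norm_nonneg (ψ n t - y (ψ n t)))
      ((norm_nonneg (ψ n t - y (ψ n t))).trans h4) h4
    have h6 : ‖X (ψ n t)‖ = ‖ψ n t - y (ψ n t)‖ * σ ‖ψ n t - y (ψ n t)‖ := by
      rw [hX, scaledField, norm_neg, norm_smul, mul_comm,
        Real.norm_of_nonneg (hσ.nonneg _ (norm_nonneg _))]
    have h7 := norm_le_norm_sub_add (scaledField (h n) y (ψ n t)) (X (ψ n t))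
    simp only at h2 h5
    linarith
  have hψint : ∀ n, ∀ t ∈ Icc 0 T,
      ∫ s in (0 : ℝ)..t, scaledField (h n) y (ψ n s) = ψ n t - x₀ := by
    intro n t ht
    have hcont : Continuous fun s => scaledField (h n) y (ψ n s) := (hK n).continuous.comp (hψc n)
    rw [intervalIntegral.integral_eq_sub_of_hasDeriv_right (hψc n).continuousOn _
      (hcont.intervalIntegrable _ _), hψeq n 0 ⟨le_rfl, hT⟩, hφ0]
    intro s hs
    rw [min_eq_left ht.1, max_eq_right ht.1] at hs
    have hsT : s ∈ Ico 0 T := ⟨hs.1.le, hs.2.trans_le ht.2⟩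
    have h1 := ((hφ n).hasDeriv s hsT).mono Ioi_subset_Ici_self
    rw [← hψeq n s (Ico_subset_Icc_self hsT)] at h1
    refine h1.congr_of_eventuallyEq ?_ (hψeq n s (Ico_subset_Icc_self hsT))
    filter_upwards [Ioo_mem_nhdsGT hsT.2] with z hz
    exact hψeq n z ⟨hsT.1.trans hz.1.le, hz.2.le⟩
  have hXf : Continuous fun s => X (f s) := hXc.comp hfc
  have hfint : ∀ t ∈ Icc 0 T, f t = x₀ + ∫ s in (0 : ℝ)..t, X (f s) := by
    intro t ht
    have h1 := intervalIntegral.tendsto_integral_filter_of_dominated_convergence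
      (μ := MeasureTheory.volume) (a := 0) (b := t)
      (F := fun n s => scaledField (h n) y (ψ n s)) (f := fun s => X (f s)) (l := atTop)
      (fun _ => 2 * (1 * σ 1) + (1 + ℓ) * R * σ ((1 + ℓ) * R))
      (.of_forall fun n => ((hK n).continuous.comp (hψc n)).aestronglyMeasurable)
      (.of_forall fun n => .of_forall fun s _ => hbound n s)
      intervalIntegrable_const (.of_forall fun s _ => hfield s)
    simp only [hψint _ t ht] at h1
    rw [tendsto_nhds_unique h1 ((hf t).sub_const x₀)]
    abel
  have h0T : (0 : ℝ) ∈ Icc 0 T := ⟨le_rfl, hT⟩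
  refine ⟨f, by rw [hfint 0 h0T, intervalIntegral.integral_same, add_zero], fun t ht => ?_⟩
  have hder : HasDerivAt (fun t => x₀ + ∫ s in (0 : ℝ)..t, X (f s)) (X (f t)) t :=
    (intervalIntegral.integral_hasDerivAt_right (hXf.intervalIntegrable _ _)
      (hXf.stronglyMeasurableAtFilter _ _) hXf.continuousAt).const_add x₀
  exact hder.hasDerivWithinAt.congr hfint (hfint t ht)

end IsConvexLyapunov

end

/-! ### Scalar comparison and the settling time -/

/-- A nonnegative function whose Dini derivative is at most `-(A w ^ α₁ + B w ^ α₂)` vanishes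
after a time which does not depend on its initial value. -/
theorem eq_zero_of_frequently_slope_lt {w : ℝ → ℝ} {A B α₁ α₂ : ℝ} (hA : 0 < A) (hB : 0 < B)
    (hα₁ : α₁ < 1) (hα₂ : 1 < α₂)
    (hc : ContinuousOn w (Icc 0 (1 / (B * (α₂ - 1)) + 1 / (A * (1 - α₁)))))
    (hanti : AntitoneOn w (Icc 0 (1 / (B * (α₂ - 1)) + 1 / (A * (1 - α₁)))))
    (hslope : ∀ t ∈ Ico 0 (1 / (B * (α₂ - 1)) + 1 / (A * (1 - α₁))), 0 < w t →
      ∀ r, -(A * w t ^ α₁ + B * w t ^ α₂) < r → ∃ᶠ z in 𝓝[>] t, slope w t z < r) :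
    w (1 / (B * (α₂ - 1)) + 1 / (A * (1 - α₁))) ≤ 0 := by
  set β := α₂ - 1 with hβ
  set γ := 1 - α₁ with hγ
  have hβ0 : 0 < β := sub_pos.2 hα₂
  have hγ0 : 0 < γ := sub_pos.2 hα₁
  set T₁ := 1 / (B * β)
  set T₂ := 1 / (A * γ)
  have hT₁ : 0 < T₁ := by positivity
  have hT₂ : 0 < T₂ := by positivity
  by_contra! hpos
  have hw : ∀ t ∈ Icc 0 (T₁ + T₂), 0 < w t := fun t ht =>
    hpos.trans_le (hanti ht ⟨by linarith, le_rfl⟩ ht.2)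
  -- Comparison with v' = -B v^α₂, v(0) = w(0), which is at most 1 at time `T₁` whatever w(0) is.
  -- The discarded term A w^α₁ > 0 supplies the strict inequality.
  have stage₁ : w T₁ ≤ 1 := by
    have hw0 := hw 0 ⟨le_rfl, by linarith⟩
    set c := w 0 ^ (-β)
    have hc0 : 0 < c := Real.rpow_pos_of_pos hw0 _
    have hbase : ∀ t : ℝ, 0 ≤ t → 0 < c + B * β * t := fun t ht => by positivity
    have hder : ∀ t : ℝ, 0 ≤ t → HasDerivAt (fun t => (c + B * β * t) ^ (-1 / β))
        (-(B * ((c + B * β * t) ^ (-1 / β)) ^ α₂)) t := fun t ht => by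
      have h1 : HasDerivAt (fun t => c + B * β * t) (B * β) t := by
        simpa using ((hasDerivAt_id t).const_mul (B * β)).const_add c
      have h2 := h1.rpow_const (p := -1 / β) (.inl (hbase t ht).ne')
      convert! h2 using 1
      rw [← Real.rpow_mul (hbase t ht).le,
        show -1 / β * α₂ = -1 / β - 1 by rw [show α₂ = β + 1 by ring]; field_simp; ring]
      field_simp
    have h := image_le_of_liminf_slope_right_lt_deriv_boundary' (a := 0) (b := T₁) (f := w)
      (f' := fun t => -(A * w t ^ α₁ + B * w t ^ α₂))
      (hc.mono (Icc_subset_Icc_right (by linarith)))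
      (fun t ht r hr => hslope t ⟨ht.1, by linarith [ht.2]⟩
        (hw t ⟨ht.1, by linarith [ht.2]⟩) r hr)
      (B := fun t => (c + B * β * t) ^ (-1 / β))
      (B' := fun t => -(B * ((c + B * β * t) ^ (-1 / β)) ^ α₂))
      (by
        simp only [c, mul_zero, add_zero]
        rw [← Real.rpow_mul hw0.le, show -β * (-1 / β) = 1 by field_simp, Real.rpow_one])
      (fun t ht => (hder t ht.1).continuousAt.continuousWithinAt)
      (fun t ht => (hder t ht.1).hasDerivWithinAt)
      (fun t ht h => by
        have := Real.rpow_pos_of_pos (hw t ⟨ht.1, by linarith [ht.2]⟩) α₁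
        rw [← h]
        nlinarith)
    refine (h ⟨hT₁.le, le_rfl⟩).trans ?_
    refine Real.rpow_le_one_of_one_le_of_nonpos ?_ ?_
    · rw [show B * β * T₁ = 1 from mul_div_cancel₀ _ (by positivity)]
      linarith
    · rw [neg_div]
      exact neg_nonpos.2 (by positivity)
  have hbase : ∀ t, t < T₁ + T₂ → 0 < 1 - A * γ * (t - T₁) := fun t ht => by
    have h1 : A * γ * (t - T₁) < A * γ * T₂ := by
      gcongr
      linarith
    rw [show A * γ * T₂ = 1 from mul_div_cancel₀ _ (by positivity)] at h1
    linarith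
  have hder : ∀ t, t < T₁ + T₂ → HasDerivAt (fun t => (1 - A * γ * (t - T₁)) ^ (1 / γ))
      (-(A * ((1 - A * γ * (t - T₁)) ^ (1 / γ)) ^ α₁)) t := fun t ht => by
    have h1 : HasDerivAt (fun t => 1 - A * γ * (t - T₁)) (-(A * γ)) t := by
      simpa using (((hasDerivAt_id t).sub_const T₁).const_mul (A * γ)).const_sub 1
    have h2 := h1.rpow_const (p := 1 / γ) (.inl (hbase t ht).ne')
    convert! h2 using 1
    rw [← Real.rpow_mul (hbase t ht).le,
      show 1 / γ * α₁ = 1 / γ - 1 by rw [show α₁ = 1 - γ by ring]; field_simp]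
    field_simp
  -- Comparison with v' = -A v^α₁, v(T₁) = 1, which reaches 0 exactly at T₁ + T₂; now B w^α₂ is the
  -- discarded term.
  have h := image_le_of_liminf_slope_right_lt_deriv_boundary' (a := T₁) (b := T₁ + T₂) (f := w)
    (f' := fun t => -(A * w t ^ α₁ + B * w t ^ α₂))
    (hc.mono (Icc_subset_Icc_left hT₁.le))
    (fun t ht r hr => hslope t ⟨hT₁.le.trans ht.1, ht.2⟩
      (hw t ⟨hT₁.le.trans ht.1, ht.2.le⟩) r hr)
    (B := fun t => (1 - A * γ * (t - T₁)) ^ (1 / γ))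
    (B' := fun t => -(A * ((1 - A * γ * (t - T₁)) ^ (1 / γ)) ^ α₁))
    (by simpa using stage₁)
    ((by fun_prop : Continuous fun t => 1 - A * γ * (t - T₁)).rpow_const
      (fun _ => .inr (by positivity))).continuousOn
    (fun t ht => (hder t ht.2).hasDerivWithinAt)
    (fun t ht h => by
      have := Real.rpow_pos_of_pos (hw t ⟨hT₁.le.trans ht.1, ht.2.le⟩) α₂
      rw [← h]
      nlinarith)
  have hend := h ⟨by linarith, le_rfl⟩
  simp only [add_sub_cancel_left] at hend
  rw [show A * γ * T₂ = 1 from mul_div_cancel₀ _ (by positivity), sub_self,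
    Real.zero_rpow (by positivity)] at hend
  linarith

/-! ### The gain of the modified proximal dynamical system -/

/-- The scaling factor of the modified proximal dynamical system as a function of the residual. -/
noncomputable def powerGain (κ₁ κ₂ α₁ α₂ r : ℝ) : ℝ :=
  if r = 0 then 0 else κ₁ * (1 / r ^ (1 - α₁)) + κ₂ * (1 / r ^ (1 - α₂))

section

variable {κ₁ κ₂ α₁ α₂ : ℝ}

theorem powerGain_of_pos {r : ℝ} (hr : 0 < r) :
    powerGain κ₁ κ₂ α₁ α₂ r = κ₁ * r ^ (α₁ - 1) + κ₂ * r ^ (α₂ - 1) := by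
  rw [powerGain, if_neg hr.ne', one_div, one_div, ← Real.rpow_neg hr.le, ← Real.rpow_neg hr.le,
    neg_sub, neg_sub]

theorem mul_powerGain (hα₁ : 0 < α₁) (hα₂ : 0 < α₂) {r : ℝ} (hr : 0 ≤ r) :
    r * powerGain κ₁ κ₂ α₁ α₂ r = κ₁ * r ^ α₁ + κ₂ * r ^ α₂ := by
  rcases hr.eq_or_lt with rfl | hr
  · rw [Real.zero_rpow hα₁.ne', Real.zero_rpow hα₂.ne']
    ring
  · rw [powerGain_of_pos hr, Real.rpow_sub_one hr.ne', Real.rpow_sub_one hr.ne']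
    field_simp

theorem isGain_powerGain (hκ₁ : 0 < κ₁) (hκ₂ : 0 < κ₂) (hα₁ : 0 < α₁) (hα₂ : 0 < α₂) :
    IsGain (powerGain κ₁ κ₂ α₁ α₂) where
  nonneg r hr := by
    rcases hr.eq_or_lt with rfl | hr
    · simp [powerGain]
    · rw [powerGain_of_pos hr]
      positivity
  exists_lipschitzOnWith a b ha := by
    have hloc : LocallyLipschitzOn (Icc a b) fun r : ℝ =>
        κ₁ * r ^ (α₁ - 1) + κ₂ * r ^ (α₂ - 1) := by
      intro x hx
      have hx0 : x ≠ 0 := (ha.trans_le hx.1).ne'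
      have hd : ContDiffAt ℝ 1 (fun r : ℝ => κ₁ * r ^ (α₁ - 1) + κ₂ * r ^ (α₂ - 1)) x :=
        (contDiffAt_const.mul (contDiffAt_id.rpow_const_of_ne hx0)).add
          (contDiffAt_const.mul (contDiffAt_id.rpow_const_of_ne hx0))
      obtain ⟨K, t, ht, hK⟩ := hd.exists_lipschitzOnWith
      exact ⟨K, t, mem_nhdsWithin_of_mem_nhds ht, hK⟩
    obtain ⟨K, hK⟩ := hloc.exists_lipschitzOnWith_of_compact isCompact_Icc
    refine ⟨K, fun x hx z hz => ?_⟩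
    rw [powerGain_of_pos (ha.trans_le hx.1), powerGain_of_pos (ha.trans_le hz.1)]
    exact hK hx hz
  monotoneOn r hr s hs hrs := by
    simp only
    rw [mul_powerGain hα₁ hα₂ hr, mul_powerGain hα₁ hα₂ hs]
    have hr0 : (0 : ℝ) ≤ r := hr
    gcongr
  tendsto_zero := by
    have h : Tendsto (fun r : ℝ => κ₁ * r ^ α₁ + κ₂ * r ^ α₂) (𝓝 0) (𝓝 0) := by
      have hc : Continuous fun r : ℝ => κ₁ * r ^ α₁ + κ₂ * r ^ α₂ :=
        (continuous_const.mul (continuous_id.rpow_const fun _ => .inr hα₁.le)).add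
          (continuous_const.mul (continuous_id.rpow_const fun _ => .inr hα₂.le))
      exact hc.tendsto' 0 0 (by simp [Real.zero_rpow hα₁.ne', Real.zero_rpow hα₂.ne'])
    refine (h.mono_left nhdsWithin_le_nhds).congr' ?_
    filter_upwards [self_mem_nhdsWithin] with r hr
    exact (mul_powerGain hα₁ hα₂ hr).symm

theorem modifiedField_eq_scaledField {E : Type*} [NormedAddCommGroup E] [InnerProductSpace ℝ E]
    (F : E → E) (g : E → EReal) (lam : ℝ) :
    modifiedField F g lam κ₁ κ₂ α₁ α₂ = scaledField
      (fun x => powerGain κ₁ κ₂ α₁ α₂ ‖x - proxStep F g lam x‖) (proxStep F g lam) := by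
  funext x
  have h : rho F g lam κ₁ κ₂ α₁ α₂ x = powerGain κ₁ κ₂ α₁ α₂ ‖x - proxStep F g lam x‖ := by
    by_cases hx : proxStep F g lam x = x
    · rw [rho, powerGain, if_pos hx, if_pos (by rw [hx, sub_self, norm_zero])]
    · rw [rho, powerGain, if_neg hx, if_neg (norm_ne_zero_iff.2 (sub_ne_zero.2 (Ne.symm hx)))]
  rw [modifiedField, scaledField, h]

theorem IsConvexLyapunov.exists_settling_bound {E : Type*} [NormedAddCommGroup E]
    [NormedSpace ℝ E] {y : E → E} {p : E} {W : E → ℝ} {ℓ M θ : ℝ}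
    (hW : IsConvexLyapunov y p W ℓ M θ) (hκ₁ : 0 < κ₁) (hκ₂ : 0 < κ₂) (hα₁ : α₁ ∈ Ioo (0 : ℝ) 1)
    (hα₂ : 1 < α₂) : ∃ T : ℝ, 0 < T ∧ ∀ φ : ℝ → E,
      IsForwardSolution (scaledField (fun x => powerGain κ₁ κ₂ α₁ α₂ ‖x - y x‖) y) φ T →
        φ T = p := by
  have hθ : 0 < 1 - θ := by linarith [hW.θ_lt_one]
  have hM := hW.M_pos
  have hℓ := hW.ℓ_nonneg
  have hσ := isGain_powerGain hκ₁ hκ₂ hα₁.1 (zero_lt_one.trans hα₂)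
  -- The exponent α₁ - 1 is negative, so `A` uses the upper bound r ≤ (1 + ℓ) W on the residual; α₂
  -- - 1 is positive, so `B` uses the lower bound r ≥ (1 - θ) W / M.
  set A := (1 - θ) * (κ₁ * (1 + ℓ) ^ (α₁ - 1)) with hA
  set B := (1 - θ) * (κ₂ * ((1 - θ) / M) ^ (α₂ - 1)) with hB
  have hA0 : 0 < A := by positivity
  have hB0 : 0 < B := by positivity
  have hα₁' : 0 < 1 - α₁ := sub_pos.2 hα₁.2
  have hα₂' : 0 < α₂ - 1 := sub_pos.2 hα₂
  refine ⟨1 / (B * (α₂ - 1)) + 1 / (A * (1 - α₁)), by positivity, fun φ hφ => ?_⟩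
  have hnn := (hσ.isTruncation y p 0 0).nonneg
  refine hW.eq_zero_iff.1 (le_antisymm ?_ (hW.nonneg _))
  refine eq_zero_of_frequently_slope_lt (w := W ∘ φ) hA0 hB0 hα₁.2 hα₂
    (hW.continuous.comp_continuousOn hφ.continuousOn) (hW.antitoneOn_comp hnn hφ)
    fun t ht hpos r hr => ?_
  refine (hW.slope_lt (hnn (φ t)) (hφ.hasDeriv t ht) (lt_of_le_of_lt (neg_le_neg ?_) hr)).frequently
  simp only [Function.comp_apply] at hpos ⊢
  have hup : ‖φ t - y (φ t)‖ ≤ (1 + ℓ) * W (φ t) := (hW.norm_residual_le _).trans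
    (mul_le_mul_of_nonneg_left (hW.norm_le _) (by positivity))
  have hlow : (1 - θ) / M * W (φ t) ≤ ‖φ t - y (φ t)‖ := by
    have := hW.le_mul_norm_residual (φ t)
    rw [div_mul_eq_mul_div, le_div_iff₀ hθ] at this
    rw [div_mul_eq_mul_div, div_le_iff₀ hM]
    linarith
  have hlow0 : 0 < (1 - θ) / M * W (φ t) := by positivity
  set r := ‖φ t - y (φ t)‖
  set ω := W (φ t)
  have hr0 : 0 < r := hlow0.trans_le hlow
  have h1 : (1 + ℓ) ^ (α₁ - 1) * ω ^ (α₁ - 1) ≤ r ^ (α₁ - 1) := by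
    rw [← Real.mul_rpow (by positivity) hpos.le]
    exact Real.rpow_le_rpow_of_nonpos hr0 hup (by linarith)
  have h2 : ((1 - θ) / M) ^ (α₂ - 1) * ω ^ (α₂ - 1) ≤ r ^ (α₂ - 1) := by
    rw [← Real.mul_rpow (by positivity) hpos.le]
    exact Real.rpow_le_rpow hlow0.le hlow hα₂'.le
  rw [powerGain_of_pos hr0, hA, hB]
  have e1 : ω ^ α₁ = ω ^ (α₁ - 1) * ω := by rw [Real.rpow_sub_one hpos.ne']; field_simp
  have e2 : ω ^ α₂ = ω ^ (α₂ - 1) * ω := by rw [Real.rpow_sub_one hpos.ne']; field_simp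
  rw [e1, e2]
  calc (1 - θ) * (κ₁ * (1 + ℓ) ^ (α₁ - 1)) * (ω ^ (α₁ - 1) * ω)
        + (1 - θ) * (κ₂ * ((1 - θ) / M) ^ (α₂ - 1)) * (ω ^ (α₂ - 1) * ω)
      = (κ₁ * ((1 + ℓ) ^ (α₁ - 1) * ω ^ (α₁ - 1))
        + κ₂ * (((1 - θ) / M) ^ (α₂ - 1) * ω ^ (α₂ - 1))) * (1 - θ) * ω := by ring
    _ ≤ (κ₁ * r ^ (α₁ - 1) + κ₂ * r ^ (α₂ - 1)) * (1 - θ) * ω := by gcongr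

end

/-! ### Global well-posedness and fixed-time stability -/

section

variable {E : Type*} [NormedAddCommGroup E] [InnerProductSpace ℝ E]
  {σ : ℝ → ℝ} {y : E → E} {p : E} {W : E → ℝ} {ℓ M θ : ℝ}

namespace IsConvexLyapunov

theorem scaledField_fixed (hW : IsConvexLyapunov y p W ℓ M θ) (h : E → ℝ) :
    scaledField h y p = 0 := by
  rw [scaledField, hW.map_fixed, sub_self, smul_zero, neg_zero]

theorem eq_target_of_le (hW : IsConvexLyapunov y p W ℓ M θ) (hσ : IsGain σ) {φ : ℝ → E}
    {s t : ℝ} (hs : 0 ≤ s) (hst : s ≤ t)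
    (hφ : IsForwardSolution (scaledField (fun x => σ ‖x - y x‖) y) φ t) (hp : φ s = p) :
    φ t = p := by
  have h := hW.antitoneOn_comp (hσ.isTruncation y p 0 0).nonneg hφ ⟨hs, hst⟩
    ⟨hs.trans hst, le_rfl⟩ hst
  simp only [Function.comp_apply, hp, hW.fixed] at h
  exact hW.eq_zero_iff.1 (h.antisymm (hW.nonneg _))

theorem forwardWellPosed [CompleteSpace E] (hW : IsConvexLyapunov y p W ℓ M θ) (hσ : IsGain σ)
    {T : ℝ} (hT : 0 < T)
    (hsettle : ∀ φ : ℝ → E,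
      IsForwardSolution (scaledField (fun x => σ ‖x - y x‖) y) φ T → φ T = p) :
    ForwardWellPosed (scaledField (fun x => σ ‖x - y x‖) y) := by
  intro x₀
  obtain ⟨φ, h0, hφ⟩ := hW.exists_solution_Icc hσ x₀ (by linarith : (0 : ℝ) ≤ T + 1)
  -- The solution rests at p on [T, T + 1]. The spare unit of time makes its extension by a constant
  -- locally constant at the gluing point.
  have hfwd : IsForwardSolution (scaledField (fun x => σ ‖x - y x‖) y) φ (T + 1) :=
    IsTrajectoryOn.isForwardSolution ⟨h0, hφ⟩ subset_rfl
  have hp : ∀ t, T ≤ t → φ (min t (T + 1)) = p := fun t ht =>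
    hW.eq_target_of_le hσ hT.le (le_min ht (by linarith)) (hfwd.mono (min_le_right _ _))
      (hsettle φ (hfwd.mono (by linarith)))
  have htraj : IsTrajectoryOn (scaledField (fun x => σ ‖x - y x‖) y) x₀ (Ici 0)
      fun t => φ (min t (T + 1)) := by
    refine ⟨by beta_reduce; rw [min_eq_left (by linarith), h0], fun t ht => ?_⟩
    beta_reduce
    rcases lt_or_ge t (T + 1) with h1 | h1
    · have heq : (fun t => φ (min t (T + 1))) =ᶠ[𝓝 t] φ := by
        filter_upwards [Iio_mem_nhds h1] with s hs
        rw [min_eq_left (le_of_lt hs)]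
      have h2 := (hφ t ⟨ht, h1.le⟩).mono_of_mem_nhdsWithin (s := Ici 0)
        (by rw [← Ici_inter_Iic]; exact inter_mem_nhdsWithin _ (Iic_mem_nhds h1))
      rw [min_eq_left h1.le]
      exact h2.congr_of_eventuallyEq (heq.filter_mono nhdsWithin_le_nhds) heq.eq_of_nhds
    · have heq : (fun t => φ (min t (T + 1))) =ᶠ[𝓝 t] fun _ => p := by
        filter_upwards [Ioi_mem_nhds (by linarith : T < t)] with s hs
        exact hp s (le_of_lt hs)
      rw [hp t (by linarith), hW.scaledField_fixed]
      exact ((hasDerivAt_const t p).congr_of_eventuallyEq heq).hasDerivWithinAt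
  refine ⟨_, htraj, fun τ ψ _ hψ t ht => ?_⟩
  exact hW.forward_unique hσ ht.1
    (hψ.isForwardSolution fun s hs => ⟨hs.1, hs.2.trans_lt ht.2⟩)
    (htraj.isForwardSolution Icc_subset_Ici_self) (hψ.1.trans htraj.1.symm)

/-- `W` decreases along solutions and lies between ‖x - p‖ and M ‖x - p‖. -/
theorem lyapunovStable (hW : IsConvexLyapunov y p W ℓ M θ) (hσ : IsGain σ) :
    LyapunovStable (scaledField (fun x => σ ‖x - y x‖) y) p := by
  intro ε hε
  refine ⟨ε / M, div_pos hε hW.M_pos, fun x₀ φ hx₀ hφ t ht => ?_⟩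
  have h := hW.le_initial (hσ.isTruncation y p 0 0).nonneg
    (hφ.isForwardSolution (T := t) Icc_subset_Ici_self) ⟨ht, le_rfl⟩
  rw [hφ.1] at h
  have h1 := (lt_div_iff₀ hW.M_pos).1 hx₀
  linarith [hW.norm_le (φ t), hW.le_mul_norm x₀]

theorem fixedTimeStable [CompleteSpace E] (hW : IsConvexLyapunov y p W ℓ M θ) (hσ : IsGain σ)
    {T : ℝ} (hT : 0 < T)
    (hsettle : ∀ φ : ℝ → E,
      IsForwardSolution (scaledField (fun x => σ ‖x - y x‖) y) φ T → φ T = p) :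
    FixedTimeStable (scaledField (fun x => σ ‖x - y x‖) y) p := by
  refine ⟨hW.scaledField_fixed _, hW.lyapunovStable hσ, ?_⟩
  choose Φ hΦ hΦu using hW.forwardWellPosed hσ hT hsettle
  have hcont : ∀ x₀, ContinuousOn (Φ x₀) (Ici 0) := fun x₀ t ht =>
    ((hΦ x₀).2 t ht).continuousWithinAt
  have hhit : ∀ x₀, Φ x₀ T = p := fun x₀ =>
    hsettle _ ((hΦ x₀).isForwardSolution Icc_subset_Ici_self)
  -- The settling time is the first hitting time of p: the infimum is attained because this set is
  -- closed, and it is at most `T`.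
  set S : E → Set ℝ := fun x₀ => Ici 0 ∩ Φ x₀ ⁻¹' {p}
  have hS : ∀ x₀, T ∈ S x₀ := fun x₀ => ⟨hT.le, hhit x₀⟩
  have hSbdd : ∀ x₀, BddBelow (S x₀) := fun x₀ => ⟨0, fun t ht => ht.1⟩
  have hSmem : ∀ x₀, sInf (S x₀) ∈ S x₀ := fun x₀ =>
    ((hcont x₀).preimage_isClosed_of_isClosed isClosed_Ici isClosed_singleton).csInf_mem
      ⟨T, hS x₀⟩ (hSbdd x₀)
  refine ⟨fun x₀ => sInf (S x₀), fun x₀ hx₀ => ?_, ⟨T, ?_⟩⟩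
  · have hne : x₀ ≠ p := hx₀.2
    have hpos : 0 < sInf (S x₀) := (hSmem x₀).1.lt_of_ne fun h => by
      have h1 : Φ x₀ (sInf (S x₀)) = p := (hSmem x₀).2
      rw [← h, (hΦ x₀).1] at h1
      exact hne h1
    refine ⟨hpos, fun φ hφ => ?_⟩
    have heq : ∀ t, 0 ≤ t → φ t = Φ x₀ t := fun t ht =>
      hΦu x₀ (t + 1) φ (by linarith) ⟨hφ.1, fun s hs => (hφ.2 s hs.1).mono Ico_subset_Ici_self⟩
        ⟨ht, by linarith⟩
    refine ⟨fun t ht => ⟨mem_univ _, fun h => ?_⟩, ?_⟩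
    · have h1 : φ t = p := h
      rw [heq t ht.1] at h1
      exact absurd ht.2 (not_lt.2 (csInf_le (hSbdd x₀) ⟨ht.1, h1⟩))
    · have h1 := (hφ.2 _ hpos.le).continuousWithinAt.continuousAt (Ici_mem_nhds hpos)
      have h2 : φ (sInf (S x₀)) = p := (heq _ hpos.le).trans (hSmem x₀).2
      rw [ContinuousAt, h2] at h1
      exact h1
  · rintro _ ⟨x₀, _, rfl⟩
    exact csInf_le (hSbdd x₀) (hS x₀)

end IsConvexLyapunov

end

end MVIP

theorem theorem2 {E : Type*} [NormedAddCommGroup E] [InnerProductSpace ℝ E]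
    [FiniteDimensional ℝ E] (F : E → E) (g : E → EReal) (μ L : ℝ) (hμ : 0 < μ) (hL : 0 < L)
    (hg : MVIP.IsProperLscConvex g) (hmono : MVIP.StronglyMonotoneOn μ F (MVIP.dom g))
    (hLip : MVIP.IsLipschitz L F) :
    (∃! x : E, MVIP.IsSolution F g x) ∧
    ∀ xs : E, MVIP.IsSolution F g xs →
      ∀ lam ∈ Set.Ioo (0 : ℝ) (2 * μ / L ^ 2), ∃ ε > (0 : ℝ),
        ∀ κ₁ > (0 : ℝ), ∀ κ₂ > (0 : ℝ),
        ∀ α₁ ∈ Set.Ioo (1 - ε) 1 ∩ Set.Ioo (0 : ℝ) 1, ∀ α₂ > (1 : ℝ),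
          Continuous (MVIP.modifiedField F g lam κ₁ κ₂ α₁ α₂) ∧
          MVIP.ForwardWellPosed (MVIP.modifiedField F g lam κ₁ κ₂ α₁ α₂) ∧
          MVIP.FixedTimeStable (MVIP.modifiedField F g lam κ₁ κ₂ α₁ α₂) xs := by
  -- The choice ε = 1 admits every α₁ in (0, 1): the decay estimate needs no closeness of α₁ to 1.
  refine ⟨MVIP.existsUnique_isSolution hμ hL hg hmono hLip, fun xs hxs lam hlam =>
    ⟨1, one_pos, fun κ₁ hκ₁ κ₂ hκ₂ α₁ hα₁ α₂ hα₂ => ?_⟩⟩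
  have : CompleteSpace E := FiniteDimensional.complete ℝ E
  obtain ⟨W, ℓ, M, θ, hW⟩ := MVIP.exists_isConvexLyapunov hL hg hmono hLip hlam hxs
  have hσ := MVIP.isGain_powerGain hκ₁ hκ₂ hα₁.2.1 (zero_lt_one.trans hα₂)
  obtain ⟨T, hT, hsettle⟩ := hW.exists_settling_bound hκ₁ hκ₂ hα₁.2 hα₂
  rw [MVIP.modifiedField_eq_scaledField]
  exact ⟨hW.continuous_scaledField hσ, hW.forwardWellPosed hσ hT hsettle,
    hW.fixedTimeStable hσ hT hsettle⟩
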